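/- Let $-\infty\le a<b\le\infty$. A real function $f$ on $(a,b)$ is called $2$-convex if $f(\lambda A+(1-\lambda)B)\le\lambda f(A)+(1-\lambda)f(B)$ for all $\lambda\in[0,1]$ and all Hermitian matrices $A,B\in M_2(\mathbb{C})$ whose eigenvalues lie in $(a,b)$. It is called $2$-monotone if $A\le B$ implies $f(A)\le f(B)$ for all such $A,B$. Let $Q_2(a,b)$ be the class of real $C^1$ functions $f$ on $(a,b)$ such that for all $\lambda_1,\lambda_2\in(a,b)$ the Loewner matrix $L=([\lambda_i,\lambda_j]_f)_{i,j=1,2}$ satisfies $\langle x, Lx\rangle\ge 0$ for every $x\in\mathbb{C}^2$ with $x_1+x_2=0$; here $[s,t]_f=\frac{f(s)-f(t)}{s-t}$ if $s\ne t$, and $[s,s]_f=f'(s)$. Then: (1) If $f$ is $2$-convex on $(a,b)$, then $f$ is differentiable on $(a,b)$ and $f'\in Q_2(a,b)$. (2) If $f$ is differentiable on $(a,b)$ and $f'$ is $2$-monotone on $(a,b)$, then $f$ is $2$-convex on $(a,b)$. (3) The function $e^t$ belongs to $Q_2(a,b)$, but it is not the derivative on $(a,b)$ of any function that is both $2$-convex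 and $2$-monotone on $(a,b)$. -/

import Mathlib

open scoped ComplexOrder

/-- The open interval `(a, b)` of the real line; the endpoints may be infinite. -/
def openInterval (a b : EReal) : Set ℝ := {t : ℝ | a < (t : EReal) ∧ (t : EReal) < b}

/-- `f` is matrix convex of order `n` on `I`. Here `cfc f A` is `f(A)`, the functional calculus of
the Hermitian matrix `A`; every `f` is continuous on the finite spectrum, so it is never a junk
value. The inequality `X ≤ Y` of Hermitian matrices is `(Y - X).PosSemidef`. -/
def MatrixConvexOn (n : ℕ) (I : Set ℝ) (f : ℝ → ℝ) : Prop :=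
  ∀ A B : Matrix (Fin n) (Fin n) ℂ, A.IsHermitian → B.IsHermitian →
    spectrum ℝ A ⊆ I → spectrum ℝ B ⊆ I →
    ∀ c : ℝ, 0 ≤ c → c ≤ 1 →
      (c • cfc f A + (1 - c) • cfc f B - cfc f (c • A + (1 - c) • B)).PosSemidef

/-- `f` is matrix monotone of order `n` on `I`. -/
def MatrixMonotoneOn (n : ℕ) (I : Set ℝ) (f : ℝ → ℝ) : Prop :=
  ∀ A B : Matrix (Fin n) (Fin n) ℂ, A.IsHermitian → B.IsHermitian →
    spectrum ℝ A ⊆ I → spectrum ℝ B ⊆ I →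
    (B - A).PosSemidef → (cfc f B - cfc f A).PosSemidef

/-- A Hermitian matrix is conditionally positive definite (almost positive) if its quadratic form is
nonnegative on the vectors whose coordinates sum to zero. -/
def CondPosDef {n : ℕ} (A : Matrix (Fin n) (Fin n) ℂ) : Prop :=
  A.IsHermitian ∧ ∀ x : Fin n → ℂ, ∑ i, x i = 0 → 0 ≤ star x ⬝ᵥ A.mulVec x

/-- The Loewner matrix of first divided differences `[l i, l j]_f`: the difference quotient of `f`
where `l i ≠ l j`, and the derivative `f' (l i)` where `l i = l j`. -/
noncomputable def loewnerMatrix {n : ℕ} (f : ℝ → ℝ) (l : Fin n → ℝ) : Matrix (Fin n) (Fin n) ℂ :=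
  Matrix.of fun i j => ((dslope f (l i) (l j) : ℝ) : ℂ)

/-- The class `Q_n(I)`, for an open interval `I`: real `C^1` functions on `I` all of whose
Loewner matrices at `n` points of `I` are conditionally positive definite. -/
def ClassQ (n : ℕ) (I : Set ℝ) : Set (ℝ → ℝ) :=
  {f | ContDiffOn ℝ 1 f I ∧
    ∀ l : Fin n → ℝ, (∀ i, l i ∈ I) → CondPosDef (loewnerMatrix f l)}

open Filter Topology Set

/-! (1) One pair of real symmetric matrices with a common first row turns 2-convexity into an
inequality for symmetric sums of `f` with steps `δ`, `2δ`, `4δ`. It says that the fourth difference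
of `f` at `x` does not increase when the step is halved. By continuity it tends to `0`, so it is
nonnegative. Hence second difference quotients decrease along dyadic steps, converge to a convex
`w`, and `f'' = w` (`exists_deriv_deriv_of_fourth_diff`). For a function with convex derivative `w`,
membership in `Q_2` is the trapezoid inequality (`mem_classQ_two_of_convexOn`).

(2) In an eigenbasis of `C = cA + (1-c)B`, the defect of convexity is a nonnegative combination of
congruences of the matrices `interpolationError` (`matrixConvexOn_of_interpolationError`). For order
two, moving the nodes toward the evaluation point along a homothety exhibits the error form as the
integral of Loewner forms of the derivative (`interpolation_form_nonneg_of_loewner`). These forms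
are the first-order terms of rank-one perturbations, so 2-monotonicity makes them nonnegative. Since
`f'` comes with no derivative, the argument is run on difference quotients and the step then tends
to zero. This works because `formIncrement` commutes with translation of its base point.

(3) The exponential has a convex derivative, so it is in `Q_2`. A primitive differs from it by a
constant, and `u < sinh u` makes its Loewner form negative at a suitable vector. -/

/-! ### Functional calculus of real symmetric matrices of order two -/

/-- The real symmetric matrix with rows `(p, q)` and `(q, d)`, with complex entries. -/
def symMat (p q d : ℝ) : Matrix (Fin 2) (Fin 2) ℂ := !![(p : ℂ), (q : ℂ); (q : ℂ), (d : ℂ)]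

lemma symMat_isHermitian (p q d : ℝ) : (symMat p q d).IsHermitian := by
  ext i j
  fin_cases i <;> fin_cases j <;> simp [symMat]

lemma symMat_add (p q d p' q' d' : ℝ) :
    symMat p q d + symMat p' q' d' = symMat (p + p') (q + q') (d + d') := by
  ext i j
  fin_cases i <;> fin_cases j <;> simp [symMat]

lemma symMat_sub (p q d p' q' d' : ℝ) :
    symMat p q d - symMat p' q' d' = symMat (p - p') (q - q') (d - d') := by
  ext i j
  fin_cases i <;> fin_cases j <;> simp [symMat]

lemma smul_symMat (c p q d : ℝ) : c • symMat p q d = symMat (c * p) (c * q) (c * d) := by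
  ext i j
  fin_cases i <;> fin_cases j <;> simp [symMat]

lemma one_eq_symMat : (1 : Matrix (Fin 2) (Fin 2) ℂ) = symMat 1 0 1 := by
  ext i j
  fin_cases i <;> fin_cases j <;> simp [symMat]

lemma posSemidef_symMat {p q d : ℝ} (h : ∀ a b : ℝ, 0 ≤ a ^ 2 * p + 2 * a * b * q + b ^ 2 * d) :
    (symMat p q d).PosSemidef := by
  refine Matrix.PosSemidef.of_dotProduct_mulVec_nonneg (symMat_isHermitian p q d) fun x => ?_
  have h1 := h (x 0).re (x 1).re
  have h2 := h (x 0).im (x 1).im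
  rw [Complex.le_def]
  simp [symMat, Matrix.mulVec, dotProduct, Fin.sum_univ_two]
  constructor
  · nlinarith
  · ring

lemma Matrix.PosSemidef.symMat_form_nonneg {p q d : ℝ} (h : (symMat p q d).PosSemidef) (a b : ℝ) :
    0 ≤ a ^ 2 * p + 2 * a * b * q + b ^ 2 * d := by
  have h1 := h.dotProduct_mulVec_nonneg ![(a : ℂ), (b : ℂ)]
  rw [Complex.le_def] at h1
  have h2 := h1.1
  simp [symMat, Matrix.mulVec, dotProduct, Fin.sum_univ_two] at h2
  nlinarith

lemma spectrum_symMat {p q d x : ℝ} (hx : x ∈ spectrum ℝ (symMat p q d)) :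
    (x - p) * (x - d) = q ^ 2 := by
  by_contra hne
  apply hx
  rw [spectrum.mem_resolventSet_iff, Matrix.isUnit_iff_isUnit_det, isUnit_iff_ne_zero, Algebra.algebraMap_eq_smul_one,
    one_eq_symMat, smul_symMat, symMat_sub, symMat, Matrix.det_fin_two_of]
  intro h0
  apply hne
  have : (((x - p) * (x - d) - q ^ 2 : ℝ) : ℂ) = 0 := by
    rw [← h0]; push_cast; ring
  have := Complex.ofReal_eq_zero.mp this
  linarith

lemma spectrum_symMat_subset {p q d μ ν : ℝ} (hs : μ + ν = p + d) (hp : μ * ν = p * d - q ^ 2) :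
    spectrum ℝ (symMat p q d) ⊆ {μ, ν} := by
  intro x hx
  have h := spectrum_symMat hx
  have : (x - μ) * (x - ν) = 0 := by
    linear_combination h - x * hs + hp
  rcases mul_eq_zero.mp this with h | h
  · left; linarith
  · right; simp; linarith

/-- On a two-point spectrum `f` agrees with its affine interpolant, and an affine function of a
matrix is computed entrywise. -/
lemma cfc_symMat (f : ℝ → ℝ) {p q d μ ν : ℝ} (hne : μ ≠ ν) (hs : μ + ν = p + d)
    (hp : μ * ν = p * d - q ^ 2) :
    cfc f (symMat p q d) = symMat ((f μ * (ν - p) + f ν * (p - μ)) / (ν - μ))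
      ((f ν - f μ) / (ν - μ) * q) ((f μ * (ν - d) + f ν * (d - μ)) / (ν - μ)) := by
  have hne' : ν - μ ≠ 0 := sub_ne_zero.mpr hne.symm
  have hsa : IsSelfAdjoint (symMat p q d) := symMat_isHermitian p q d
  set β := (f ν - f μ) / (ν - μ) with hβ
  have h1 : Set.EqOn f (fun x => (f μ - β * μ) + β * x) (spectrum ℝ (symMat p q d)) := by
    intro x hx
    rcases spectrum_symMat_subset hs hp hx with rfl | hx
    · simp
    · rw [Set.mem_singleton_iff.mp hx]
      simp only [hβ]
      field_simp
      ring
  rw [cfc_congr h1, cfc_const_add (f μ - β * μ) (fun x => β * x) (symMat p q d),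
    cfc_const_mul_id β (symMat p q d), Algebra.algebraMap_eq_smul_one, one_eq_symMat, smul_symMat,
    smul_symMat, symMat_add]
  congr 1
  · simp only [hβ]; field_simp; ring
  · simp
  · simp only [hβ]; field_simp; ring

lemma spectrum_scalar_symMat {x : ℝ} : spectrum ℝ (symMat x 0 x) ⊆ {x} := by
  have := spectrum_symMat_subset (p := x) (q := 0) (d := x) (μ := x) (ν := x) rfl (by ring)
  simpa using this

lemma cfc_scalar_symMat (f : ℝ → ℝ) (x : ℝ) : cfc f (symMat x 0 x) = symMat (f x) 0 (f x) := by
  have hsa : IsSelfAdjoint (symMat x 0 x) := symMat_isHermitian x 0 x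
  have h1 : Set.EqOn f (fun _ => f x) (spectrum ℝ (symMat x 0 x)) := by
    intro y hy
    rw [Set.mem_singleton_iff.mp (spectrum_scalar_symMat hy)]
  rw [cfc_congr h1, cfc_const (f x) (symMat x 0 x), Algebra.algebraMap_eq_smul_one, one_eq_symMat,
    smul_symMat]
  simp

/-! ### Scalar inequalities from 2-convexity -/

/-- A matrix convex function of order two is convex. -/
lemma MatrixConvexOn.convexOn {I : Set ℝ} {f : ℝ → ℝ} (hI : Convex ℝ I) (h : MatrixConvexOn 2 I f) :
    ConvexOn ℝ I f := by
  refine ⟨hI, fun x hx y hy s t hs ht hst => ?_⟩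
  have h1 := h (symMat x 0 x) (symMat y 0 y) (symMat_isHermitian ..) (symMat_isHermitian ..)
    (spectrum_scalar_symMat.trans (by simpa)) (spectrum_scalar_symMat.trans (by simpa)) s hs
    (by linarith)
  obtain rfl : t = 1 - s := by linarith
  rw [smul_symMat, smul_symMat, symMat_add, mul_zero, mul_zero, add_zero, cfc_scalar_symMat,
    cfc_scalar_symMat, cfc_scalar_symMat, smul_symMat, smul_symMat, symMat_add, symMat_sub] at h1
  have h2 := h1.symMat_form_nonneg 1 0
  simp only [smul_eq_mul]
  linarith

/-- The inequality for symmetric sums that comes from two matrices with the same first row. -/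
lemma MatrixConvexOn.symmetric_sum_ineq {I : Set ℝ} {f : ℝ → ℝ} (h : MatrixConvexOn 2 I f)
    {x δ : ℝ} (hδ : 0 < δ) (h1 : x + 4 * δ ∈ I) (h2 : x - δ ∈ I) (h3 : x - 4 * δ ∈ I)
    (h4 : x + δ ∈ I) :
    5 * (f (x + 2 * δ) + f (x - 2 * δ)) ≤
      f (x + 4 * δ) + f (x - 4 * δ) + 4 * (f (x + δ) + f (x - δ)) := by
  have e1 : (x + 4 * δ) + (x - δ) = x + (x + 3 * δ) := by ring
  have e2 : (x + 4 * δ) * (x - δ) = x * (x + 3 * δ) - (2 * δ) ^ 2 := by ring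
  have e3 : (x - 4 * δ) + (x + δ) = x + (x - 3 * δ) := by ring
  have e4 : (x - 4 * δ) * (x + δ) = x * (x - 3 * δ) - (2 * δ) ^ 2 := by ring
  have e5 : (x + 2 * δ) + (x - 2 * δ) = x + x := by ring
  have e6 : (x + 2 * δ) * (x - 2 * δ) = x * x - (2 * δ) ^ 2 := by ring
  have n1 : x + 4 * δ ≠ x - δ := by intro h; linarith
  have n2 : x - 4 * δ ≠ x + δ := by intro h; linarith
  have n3 : x + 2 * δ ≠ x - 2 * δ := by intro h; linarith
  -- The eigenvalues are `x + 4δ, x - δ` and `x - 4δ, x + δ`; those of the midpoint are `x ± 2δ`.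
  -- Only the upper left entry of the resulting inequality is used.
  have key := h (symMat x (2 * δ) (x + 3 * δ)) (symMat x (2 * δ) (x - 3 * δ))
    (symMat_isHermitian ..) (symMat_isHermitian ..)
    ((spectrum_symMat_subset e1 e2).trans (by rintro y (rfl | rfl) <;> assumption))
    ((spectrum_symMat_subset e3 e4).trans (by rintro y (rfl | rfl) <;> assumption))
    (1 / 2) (by norm_num) (by norm_num)
  have e7 : (1 / 2 : ℝ) • symMat x (2 * δ) (x + 3 * δ) +
      (1 - 1 / 2 : ℝ) • symMat x (2 * δ) (x - 3 * δ) = symMat x (2 * δ) x := by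
    rw [smul_symMat, smul_symMat, symMat_add]
    congr 1 <;> ring
  rw [e7, cfc_symMat f n1 e1 e2, cfc_symMat f n2 e3 e4, cfc_symMat f n3 e5 e6, smul_symMat,
    smul_symMat, symMat_add, symMat_sub] at key
  have := key.symMat_form_nonneg 1 0
  have d1 : x - δ - (x + 4 * δ) = -(5 * δ) := by ring
  have d2 : x + δ - (x - 4 * δ) = 5 * δ := by ring
  have d3 : x - 2 * δ - (x + 2 * δ) = -(4 * δ) := by ring
  rw [d1, d2, d3] at this
  have e : 1 / 2 * ((f (x + 4 * δ) * (x - δ - x) + f (x - δ) * (x - (x + 4 * δ))) / -(5 * δ)) +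
      (1 - 1 / 2) * ((f (x - 4 * δ) * (x + δ - x) + f (x + δ) * (x - (x - 4 * δ))) / (5 * δ)) -
      (f (x + 2 * δ) * (x - 2 * δ - x) + f (x - 2 * δ) * (x - (x + 2 * δ))) / -(4 * δ) =
      (f (x + 4 * δ) + f (x - 4 * δ) + 4 * (f (x + δ) + f (x - δ)) -
        5 * (f (x + 2 * δ) + f (x - 2 * δ))) / 10 := by
    field_simp
    ring
  rw [e] at this
  linarith

/-! ### Second and fourth differences -/

/-- The central second difference of `f` with step `δ`. -/
def secondDiff (f : ℝ → ℝ) (δ x : ℝ) : ℝ := f (x + δ) + f (x - δ) - 2 * f x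

/-- A continuous function whose second differences are asymptotically nonnegative along small steps
is convex. -/
lemma convexOn_of_frequently_secondDiff {I : Set ℝ} (hc : Convex ℝ I) {F : ℝ → ℝ}
    (hF : ContinuousOn F I)
    (h : ∀ x ∈ I, ∀ ε > 0, ∃ᶠ η in 𝓝[>] (0 : ℝ), -ε * η ^ 2 ≤ secondDiff F η x) :
    ConvexOn ℝ I F := by
  refine LinearOrder.convexOn_of_lt hc fun x hx y hy hxy a b ha hb hab => ?_
  simp only [smul_eq_mul]
  have hsub : Icc x y ⊆ I := hc.ordConnected.out hx hy
  set z := a * x + b * y with hz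
  have hzx : 0 < z - x := by
    have : z - x = b * (y - x) := by rw [hz]; linear_combination x * hab
    rw [this]; exact mul_pos hb (by linarith)
  have hzy : 0 < y - z := by
    have : y - z = a * (y - x) := by rw [hz]; linear_combination -y * hab
    rw [this]; exact mul_pos ha (by linarith)
  have key : ∀ ε > 0, F z ≤ a * F x + b * F y + ε * ((z - x) * (y - z)) := by
    intro ε hε
    set m := (F y - F x) / (y - x) with hm
    have hmy : m * (y - x) = F y - F x := by rw [hm]; field_simp [sub_ne_zero.mpr hxy.ne']
    -- Maximum principle: the quadratic term adds `2εη²` to the second difference, so that of `g` is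
    -- positive for some small `η`, which excludes an interior maximum. At both ends `g` vanishes.
    set g : ℝ → ℝ := fun t => F t - (F x + m * (t - x)) + ε * ((t - x) * (t - y)) with hg
    have hgc : ContinuousOn g (Icc x y) :=
      ((hF.mono hsub).sub (by fun_prop)).add (by fun_prop)
    obtain ⟨c, hcI, hmax⟩ := isCompact_Icc.exists_isMaxOn (nonempty_Icc.mpr hxy.le) hgc
    have hgx : g x = 0 := by simp [hg]
    have hgy : g y = 0 := by simp [hg]; linarith
    have hc0 : g c ≤ 0 := by
      by_contra! hpos
      have hcx : x < c := lt_of_le_of_ne hcI.1 (by rintro rfl; linarith)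
      have hcy : c < y := lt_of_le_of_ne hcI.2 (by rintro rfl; linarith)
      have hev : ∀ᶠ η in 𝓝[>] (0 : ℝ), η ∈ Ioo 0 (min (c - x) (y - c)) :=
        Ioo_mem_nhdsGT (lt_min (by linarith) (by linarith))
      obtain ⟨η, h1, h2, h3⟩ := ((h c (hsub hcI) ε hε).and_eventually hev).exists
      have h4 := h3.trans_le (min_le_left _ _)
      have h5 := h3.trans_le (min_le_right _ _)
      have m1 : g (c + η) ≤ g c := hmax ⟨by linarith, by linarith⟩
      have m2 : g (c - η) ≤ g c := hmax ⟨by linarith, by linarith⟩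
      simp only [hg] at m1 m2
      unfold secondDiff at h1
      nlinarith [mul_pos hε (pow_pos h2 2)]
    have : g z ≤ 0 := (hmax ⟨by linarith, by linarith⟩ : g z ≤ g c).trans hc0
    have e : F x + m * (z - x) = a * F x + b * F y := by
      have : z - x = b * (y - x) := by rw [hz]; linear_combination x * hab
      rw [this]; linear_combination b * hmy - F x * hab
    simp only [hg] at this
    rw [e] at this
    linarith
  refine le_of_forall_pos_le_add fun e he => ?_
  have hp : 0 < (z - x) * (y - z) := mul_pos hzx hzy
  have := key (e / ((z - x) * (y - z))) (div_pos he hp)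
  rwa [div_mul_cancel₀ _ hp.ne'] at this

lemma secondDiff_two_mul (f : ℝ → ℝ) (δ x : ℝ) :
    secondDiff f (2 * δ) x =
      secondDiff f δ (x + δ) + 2 * secondDiff f δ x + secondDiff f δ (x - δ) := by
  unfold secondDiff
  rw [show x + δ + δ = x + 2 * δ by ring, show x - δ - δ = x - 2 * δ by ring,
    show x + δ - δ = x by ring, show x - δ + δ = x by ring]
  ring

lemma secondDiff_secondDiff_self (f : ℝ → ℝ) (δ x : ℝ) :
    secondDiff (secondDiff f δ) δ x =
      f (x + 2 * δ) + f (x - 2 * δ) - 4 * (f (x + δ) + f (x - δ)) + 6 * f x := by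
  unfold secondDiff
  rw [show x + δ + δ = x + 2 * δ by ring, show x - δ - δ = x - 2 * δ by ring,
    show x + δ - δ = x by ring, show x - δ + δ = x by ring]
  ring

lemma secondDiff_sub (f g : ℝ → ℝ) (δ x : ℝ) :
    secondDiff (fun t => f t - g t) δ x = secondDiff f δ x - secondDiff g δ x := by
  unfold secondDiff; ring

lemma tendsto_pow_half : Tendsto (fun n : ℕ => (1 / 2 : ℝ) ^ n) atTop (𝓝[>] 0) :=
  tendsto_nhdsWithin_iff.mpr
    ⟨tendsto_pow_atTop_nhds_zero_of_lt_one (by norm_num) (by norm_num),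
      Eventually.of_forall fun n => by simp⟩

/-- The hypothesis is exactly `T η ≤ T (2η)` for the fourth difference `T` at `x`. So `T δ`
dominates its values along repeated halving, which tend to `0`. -/
lemma secondDiff_secondDiff_nonneg {I : Set ℝ} (hI : IsOpen I) (hc : Convex ℝ I) {f : ℝ → ℝ}
    (hf : ContinuousOn f I)
    (h : ∀ x δ : ℝ, 0 < δ → x + 4 * δ ∈ I → x - 4 * δ ∈ I →
      5 * (f (x + 2 * δ) + f (x - 2 * δ)) ≤
        f (x + 4 * δ) + f (x - 4 * δ) + 4 * (f (x + δ) + f (x - δ)))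
    {x δ : ℝ} (hδ : 0 < δ) (h1 : x + 2 * δ ∈ I) (h2 : x - 2 * δ ∈ I) :
    0 ≤ secondDiff (secondDiff f δ) δ x := by
  have hx : x ∈ I := hc.ordConnected.out h2 h1 ⟨by linarith, by linarith⟩
  set T : ℝ → ℝ := fun η => secondDiff (secondDiff f η) η x with hT
  have hstep : ∀ n : ℕ, T ((1 / 2) ^ n * δ) ≤ T δ := by
    intro n
    induction n with
    | zero => simp
    | succ n ih =>
      refine le_trans ?_ ih
      set η := (1 / 2 : ℝ) ^ (n + 1) * δ with hη
      have e : (1 / 2 : ℝ) ^ n * δ = 2 * η := by rw [hη, pow_succ]; ring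
      have hη0 : 0 < η := by positivity
      have hle : 2 * η ≤ δ := by
        rw [← e]
        exact mul_le_of_le_one_left hδ.le (pow_le_one₀ (by norm_num) (by norm_num))
      have := h x η hη0 (hc.ordConnected.out h2 h1 ⟨by linarith, by linarith⟩)
        (hc.ordConnected.out h2 h1 ⟨by linarith, by linarith⟩)
      rw [e]
      simp only [hT, secondDiff_secondDiff_self]
      rw [show x + 2 * (2 * η) = x + 4 * η by ring, show x - 2 * (2 * η) = x - 4 * η by ring]
      linarith
  have hfx : ContinuousAt f x := hf.continuousAt (hI.mem_nhds hx)
  have hTc : Tendsto T (𝓝 0) (𝓝 0) := by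
    have hadd : ∀ c : ℝ, Tendsto (fun η : ℝ => f (x + c * η)) (𝓝 0) (𝓝 (f x)) := fun c =>
      hfx.tendsto.comp (Continuous.tendsto' (by fun_prop) _ _ (by simp))
    have := (((hadd 2).add (hadd (-2))).sub (((hadd 1).add (hadd (-1))).const_mul 4)).add_const
      (6 * f x)
    have e : f x + f x - 4 * (f x + f x) + 6 * f x = 0 := by ring
    rw [e] at this
    refine this.congr fun η => ?_
    simp only [hT, secondDiff_secondDiff_self]
    ring_nf
  have hlim : Tendsto (fun n : ℕ => T ((1 / 2) ^ n * δ)) atTop (𝓝 0) := by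
    refine hTc.comp ?_
    simpa using (tendsto_nhds_of_tendsto_nhdsWithin tendsto_pow_half).mul_const δ
  exact le_of_tendsto' hlim hstep

/-- Decouples the two steps: a second difference of step `2η` is a positive combination of those of
step `η` at `x + η`, `x`, `x - η`, so the outer step can be kept while the inner one is halved. -/
lemma secondDiff_secondDiff_nonneg_of_self {I : Set ℝ} (hc : Convex ℝ I) {f : ℝ → ℝ}
    (h : ∀ x δ : ℝ, 0 < δ → x + 2 * δ ∈ I → x - 2 * δ ∈ I → 0 ≤ secondDiff (secondDiff f δ) δ x)
    (m : ℕ) : ∀ x δ : ℝ, 0 < δ → x + (δ + δ * (1 / 2) ^ m) ∈ I → x - (δ + δ * (1 / 2) ^ m) ∈ I →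
      0 ≤ secondDiff (secondDiff f δ) (δ * (1 / 2) ^ m) x := by
  induction m with
  | zero =>
    intro x δ hδ h1 h2
    simp only [pow_zero, mul_one, ← two_mul] at h1 h2 ⊢
    exact h x δ hδ h1 h2
  | succ m ih =>
    intro x δ hδ h1 h2
    obtain ⟨η, rfl⟩ : ∃ η, δ = 2 * η := ⟨δ / 2, by ring⟩
    have hη : 0 < η := by linarith
    have e : 2 * η * (1 / 2) ^ (m + 1) = η * (1 / 2) ^ m := by rw [pow_succ]; ring
    rw [e] at h1 h2 ⊢
    set κ := η * (1 / 2) ^ m with hκ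
    have hκ0 : 0 < κ := by positivity
    have hin : ∀ y, x - (2 * η + κ) ≤ y → y ≤ x + (2 * η + κ) → y ∈ I := fun y hy1 hy2 =>
      hc.ordConnected.out h2 h1 ⟨hy1, hy2⟩
    have a1 := ih (x + η) η hη (hin _ (by linarith) (by linarith)) (hin _ (by linarith) (by linarith))
    have a2 := ih x η hη (hin _ (by linarith) (by linarith)) (hin _ (by linarith) (by linarith))
    have a3 := ih (x - η) η hη (hin _ (by linarith) (by linarith)) (hin _ (by linarith) (by linarith))
    have : secondDiff (secondDiff f (2 * η)) κ x = secondDiff (secondDiff f η) κ (x + η) +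
        2 * secondDiff (secondDiff f η) κ x + secondDiff (secondDiff f η) κ (x - η) := by
      have hu : ∀ (F : ℝ → ℝ) (y : ℝ), secondDiff F κ y = F (y + κ) + F (y - κ) - 2 * F y :=
        fun _ _ => rfl
      rw [hu, hu, hu, hu, secondDiff_two_mul, secondDiff_two_mul, secondDiff_two_mul, show x + κ + η = x + η + κ by ring,
        show x + κ - η = x - η + κ by ring, show x - κ + η = x + η - κ by ring,
        show x - κ - η = x - η - κ by ring]
      ring
    rw [this]
    linarith

lemma convexOn_secondDiff {I : Set ℝ} (hI : IsOpen I) (hc : Convex ℝ I) {f : ℝ → ℝ}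
    (hf : ContinuousOn f I)
    (h : ∀ x δ : ℝ, 0 < δ → x + 2 * δ ∈ I → x - 2 * δ ∈ I → 0 ≤ secondDiff (secondDiff f δ) δ x)
    {δ : ℝ} (hδ : 0 < δ) : ConvexOn ℝ {x | x + δ ∈ I ∧ x - δ ∈ I} (secondDiff f δ) := by
  have hsub : ∀ x, x + δ ∈ I → x - δ ∈ I → x ∈ I := fun x h1 h2 =>
    hc.ordConnected.out h2 h1 ⟨by linarith, by linarith⟩
  refine convexOn_of_frequently_secondDiff ?_ ?_ ?_
  · refine convex_iff_ordConnected.mpr ⟨fun x hx y hy z hz => ⟨?_, ?_⟩⟩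
    · exact hc.ordConnected.out hx.1 hy.1 ⟨by linarith [hz.1], by linarith [hz.2]⟩
    · exact hc.ordConnected.out hx.2 hy.2 ⟨by linarith [hz.1], by linarith [hz.2]⟩
  · unfold secondDiff
    refine ContinuousOn.sub (ContinuousOn.add ?_ ?_) (ContinuousOn.mul continuousOn_const ?_)
    · exact hf.comp (by fun_prop) fun x hx => hx.1
    · exact hf.comp (by fun_prop) fun x hx => hx.2
    · exact hf.mono fun x hx => hsub x hx.1 hx.2
  · intro x hx ε hε
    have ht : Tendsto (fun n : ℕ => δ * (1 / 2 : ℝ) ^ n) atTop (𝓝[>] 0) := by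
      refine tendsto_nhdsWithin_iff.mpr ⟨?_, Eventually.of_forall fun n => by simp; positivity⟩
      simpa using (tendsto_nhds_of_tendsto_nhdsWithin tendsto_pow_half).const_mul δ
    refine ht.frequently (Eventually.frequently ?_)
    have ht0 := tendsto_nhds_of_tendsto_nhdsWithin ht
    have e1 : Tendsto (fun n : ℕ => x + (δ + δ * (1 / 2 : ℝ) ^ n)) atTop (𝓝 (x + δ)) := by
      simpa using (ht0.const_add δ).const_add x
    have e2 : Tendsto (fun n : ℕ => x - (δ + δ * (1 / 2 : ℝ) ^ n)) atTop (𝓝 (x - δ)) := by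
      simpa using (ht0.const_add δ).const_sub x
    filter_upwards [e1.eventually_mem (hI.mem_nhds hx.1), e2.eventually_mem (hI.mem_nhds hx.2)]
      with n h1 h2
    have := secondDiff_secondDiff_nonneg_of_self hc h n x δ hδ h1 h2
    nlinarith [mul_nonneg hε.le (sq_nonneg (δ * (1 / 2 : ℝ) ^ n))]

/-- The second difference quotients of a convex function with nonnegative fourth differences
converge along dyadic steps, and the limit is convex. -/
lemma exists_convexOn_tendsto_secondDiff {I : Set ℝ} (hI : IsOpen I) {f : ℝ → ℝ}
    (hf : ConvexOn ℝ I f)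
    (h : ∀ x δ : ℝ, 0 < δ → x + 2 * δ ∈ I → x - 2 * δ ∈ I → 0 ≤ secondDiff (secondDiff f δ) δ x) :
    ∃ w : ℝ → ℝ, ConvexOn ℝ I w ∧ ∀ x ∈ I, Tendsto
      (fun n : ℕ => secondDiff f ((1 / 2) ^ n) x / ((1 / 2) ^ n) ^ 2) atTop (𝓝 (w x)) := by
  have hc := hf.1
  set δ : ℕ → ℝ := fun n => (1 / 2) ^ n with hδ
  have hδ0 : ∀ n, 0 < δ n := fun n => by simp [hδ]
  have hδs : ∀ n, δ n = 2 * δ (n + 1) := fun n => by simp only [hδ, pow_succ]; ring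
  have hin : ∀ x ∈ I, ∀ᶠ n in atTop, x + δ n ∈ I ∧ x - δ n ∈ I := by
    intro x hx
    have ht := tendsto_nhds_of_tendsto_nhdsWithin tendsto_pow_half
    have e1 : Tendsto (fun n : ℕ => x + δ n) atTop (𝓝 x) := by
      simpa [hδ] using ht.const_add x
    have e2 : Tendsto (fun n : ℕ => x - δ n) atTop (𝓝 x) := by simpa [hδ] using ht.const_sub x
    exact (e1.eventually_mem (hI.mem_nhds hx)).and (e2.eventually_mem (hI.mem_nhds hx))
  have hex : ∀ x ∈ I, ∃ l, Tendsto (fun n => secondDiff f (δ n) x / δ n ^ 2) atTop (𝓝 l) := by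
    intro x hx
    obtain ⟨N, hN⟩ := eventually_atTop.mp (hin x hx)
    set u : ℕ → ℝ := fun n => secondDiff f (δ (n + N)) x / δ (n + N) ^ 2 with hu
    have hanti : Antitone u := by
      refine antitone_nat_of_succ_le fun n => ?_
      have hm := hN (n + N) (by omega)
      have e := hδs (n + N)
      have e' : n + 1 + N = n + N + 1 := by omega
      simp only [hu, e']
      rw [e] at hm ⊢
      have h1 := h x _ (hδ0 (n + N + 1)) hm.1 hm.2
      set η := δ (n + N + 1)
      have hη : 0 < η := hδ0 _
      have h2 := secondDiff_two_mul f η x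
      rw [div_le_div_iff₀ (by positivity) (by positivity)]
      unfold secondDiff at h1
      -- The difference of the two sides is the fourth difference with step `η`.
      have h3 : 4 * secondDiff f η x ≤ secondDiff f (2 * η) x := by
        rw [h2]; unfold secondDiff; linarith
      nlinarith [mul_le_mul_of_nonneg_right h3 (sq_nonneg η)]
    have hbdd : BddBelow (range u) := by
      refine ⟨0, ?_⟩
      rintro _ ⟨n, rfl⟩
      have hm := hN (n + N) (by omega)
      have h1 := hf.2 hm.1 hm.2 (show (0 : ℝ) ≤ 1 / 2 by norm_num) (show (0 : ℝ) ≤ 1 / 2 by norm_num)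
        (by norm_num)
      have e : (1 / 2 : ℝ) • (x + δ (n + N)) + (1 / 2 : ℝ) • (x - δ (n + N)) = x := by
        simp only [smul_eq_mul]; ring
      rw [e] at h1
      simp only [smul_eq_mul] at h1
      refine div_nonneg ?_ (sq_nonneg _)
      unfold secondDiff
      linarith
    exact ⟨_, (tendsto_add_atTop_iff_nat N).mp (tendsto_atTop_ciInf hanti hbdd)⟩
  choose! w hw using hex
  refine ⟨w, ⟨hc, fun x hx y hy a b ha hb hab => ?_⟩, hw⟩
  have hz : a • x + b • y ∈ I := hc hx hy ha hb hab
  refine le_of_tendsto_of_tendsto (hw _ hz) (((hw x hx).const_smul a).add ((hw y hy).const_smul b))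
    ?_
  filter_upwards [hin x hx, hin y hy] with n h1 h2
  have := (convexOn_secondDiff hI hc (hf.continuousOn hI) h (hδ0 n)).2 h1 h2 ha hb hab
  simp only [smul_eq_mul] at this ⊢
  rw [mul_div_assoc', mul_div_assoc', ← add_div]
  exact div_le_div_of_nonneg_right this (sq_nonneg _)

/-! ### Recovering the second derivative -/

lemma exists_antideriv {I : Set ℝ} (hI : IsOpen I) (hc : Convex ℝ I) {w : ℝ → ℝ}
    (hw : ContinuousOn w I) : ∃ W : ℝ → ℝ, ∀ x ∈ I, HasDerivAt W (w x) x := by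
  rcases I.eq_empty_or_nonempty with rfl | ⟨x₀, hx₀⟩
  · exact ⟨0, by simp⟩
  refine ⟨fun x => ∫ t in x₀..x, w t, fun x hx => ?_⟩
  have hsub : uIcc x₀ x ⊆ I := hc.ordConnected.uIcc_subset hx₀ hx
  exact intervalIntegral.integral_hasDerivAt_right (hw.mono hsub).intervalIntegrable
    (hw.stronglyMeasurableAtFilter hI x hx) (hw.continuousAt (hI.mem_nhds hx))

/-- L'Hôpital is applied only once, because `G'` is differentiable merely at `x`; the remaining
symmetric quotient is the mean of two one-sided ones. -/
lemma tendsto_secondDiff_div {G G' : ℝ → ℝ} {w x : ℝ} (hG : ∀ᶠ y in 𝓝 x, HasDerivAt G (G' y) y)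
    (hG' : HasDerivAt G' w x) :
    Tendsto (fun η => secondDiff G η x / η ^ 2) (𝓝[>] 0) (𝓝 w) := by
  have hp : Tendsto (fun η : ℝ => x + η) (𝓝[>] 0) (𝓝 x) :=
    (Continuous.tendsto' (by fun_prop) _ _ (by simp)).mono_left nhdsWithin_le_nhds
  have hm : Tendsto (fun η : ℝ => x - η) (𝓝[>] 0) (𝓝 x) :=
    (Continuous.tendsto' (by fun_prop) _ _ (by simp)).mono_left nhdsWithin_le_nhds
  have hGc : Tendsto G (𝓝 x) (𝓝 (G x)) := hG.self_of_nhds.continuousAt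
  refine HasDerivAt.lhopital_zero_nhdsGT (f' := fun η => G' (x + η) - G' (x - η))
    (g' := fun η => 2 * η) ?_ ?_ ?_ ?_ ?_ ?_
  · filter_upwards [hp.eventually hG, hm.eventually hG] with η h1 h2
    have a1 := h1.comp_const_add x η
    have a2 := h2.comp_const_sub x η
    exact ((a1.add a2).sub_const (2 * G x)).congr_deriv (sub_eq_add_neg _ _).symm
  · exact Eventually.of_forall fun η => by simpa using hasDerivAt_pow 2 η
  · filter_upwards [self_mem_nhdsWithin] with η hη
    have : (0 : ℝ) < η := hη
    positivity
  · have := ((hGc.comp hp).add (hGc.comp hm)).sub_const (2 * G x)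
    rwa [show G x + G x - 2 * G x = 0 by ring] at this
  · exact (Continuous.tendsto' (by fun_prop) _ _ (by simp)).mono_left nhdsWithin_le_nhds
  · have hs := hasDerivAt_iff_tendsto_slope_zero.mp hG'
    have h1 : Tendsto (fun η : ℝ => η⁻¹ • (G' (x + η) - G' x)) (𝓝[>] 0) (𝓝 w) :=
      hs.mono_left (nhdsWithin_mono _ fun y hy => ne_of_gt hy)
    have hneg : Tendsto (fun η : ℝ => -η) (𝓝[>] 0) (𝓝[≠] 0) :=
      tendsto_nhdsWithin_iff.mpr
        ⟨(Continuous.tendsto' (by fun_prop) _ _ (by simp)).mono_left nhdsWithin_le_nhds, by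
          filter_upwards [self_mem_nhdsWithin] with η hη
          have : (0 : ℝ) < η := hη
          simpa using this.ne'⟩
    have h2 := hs.comp hneg
    have h3 := (h1.add h2).div_const 2
    rw [show (w + w) / 2 = w by ring] at h3
    refine h3.congr' ?_
    filter_upwards [self_mem_nhdsWithin] with η hη
    have : (0 : ℝ) < η := hη
    simp only [Function.comp, smul_eq_mul, ← sub_eq_add_neg]
    field_simp
    ring

lemma exists_affine_of_convexOn_of_concaveOn {I : Set ℝ} (hI : IsOpen I) {u : ℝ → ℝ}
    (h1 : ConvexOn ℝ I u) (h2 : ConcaveOn ℝ I u) : ∃ α β : ℝ, ∀ x ∈ I, u x = α * x + β := by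
  rcases I.eq_empty_or_nonempty with rfl | ⟨p, hp⟩
  · exact ⟨0, 0, by simp⟩
  obtain ⟨q, hpq, hq⟩ : ∃ q, p < q ∧ q ∈ I := by
    have : ∀ᶠ q in 𝓝[>] p, q ∈ I := mem_nhdsWithin_of_mem_nhds (hI.mem_nhds hp)
    obtain ⟨q, h⟩ := (this.and self_mem_nhdsWithin).exists
    exact ⟨q, h.2, h.1⟩
  have key : ∀ {x y z : ℝ}, x ∈ I → z ∈ I → x < y → y < z →
      (u y - u x) * (z - y) = (u z - u y) * (y - x) := by
    intro x y z hx hz hxy hyz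
    have := le_antisymm (h1.slope_mono_adjacent hx hz hxy hyz)
      (h2.slope_anti_adjacent hx hz hxy hyz)
    rwa [div_eq_div_iff (by linarith) (by linarith)] at this
  set α := (u q - u p) / (q - p) with hα
  have hαm : α * (q - p) = u q - u p := div_mul_cancel₀ _ (by linarith)
  have hne : q - p ≠ 0 := by linarith
  refine ⟨α, u p - α * p, fun x hx => ?_⟩
  refine mul_left_cancel₀ hne ?_
  have goal : (q - p) * (u x - u p) = (u q - u p) * (x - p) := by
    rcases lt_trichotomy x p with h | rfl | h
    · linear_combination -key hx hq h hpq
    · ring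
    · rcases lt_trichotomy x q with h' | rfl | h'
      · linear_combination key hp hq h h'
      · ring
      · linear_combination -key hp hx hpq h'
  linear_combination goal - (x - p) * hαm

/-- A convex function with nonnegative fourth differences has a convex second derivative. -/
lemma exists_deriv_deriv_of_fourth_diff {I : Set ℝ} (hI : IsOpen I) {f : ℝ → ℝ}
    (hf : ConvexOn ℝ I f)
    (h : ∀ x δ : ℝ, 0 < δ → x + 2 * δ ∈ I → x - 2 * δ ∈ I → 0 ≤ secondDiff (secondDiff f δ) δ x) :
    ∃ g w : ℝ → ℝ, (∀ x ∈ I, HasDerivAt f (g x) x) ∧ (∀ x ∈ I, HasDerivAt g (w x) x) ∧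
      ConvexOn ℝ I w := by
  obtain ⟨w, hwc, hw⟩ := exists_convexOn_tendsto_secondDiff hI hf h
  obtain ⟨G', hG'⟩ := exists_antideriv hI hf.1 (hwc.continuousOn hI)
  obtain ⟨G, hG⟩ := exists_antideriv hI hf.1 (w := G')
    fun x hx => (hG' x hx).continuousAt.continuousWithinAt
  have hfc := hf.continuousOn hI
  have hGc : ContinuousOn G I := fun x hx => (hG x hx).continuousAt.continuousWithinAt
  have hlim : ∀ x ∈ I, Tendsto (fun n : ℕ =>
      secondDiff (fun t => f t - G t) ((1 / 2) ^ n) x / ((1 / 2) ^ n) ^ 2) atTop (𝓝 0) := by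
    intro x hx
    have h1 := (tendsto_secondDiff_div (eventually_of_mem (hI.mem_nhds hx) hG) (hG' x hx)).comp
      tendsto_pow_half
    have h2 := (hw x hx).sub h1
    rw [sub_self] at h2
    refine h2.congr fun n => ?_
    rw [secondDiff_sub, sub_div]
    rfl
  have hpos : ∀ n : ℕ, 0 < ((1 / 2 : ℝ) ^ n) ^ 2 := fun n => by positivity
  -- Second difference quotients of `f - G` tend to zero, so both it and its negative pass the
  -- convexity test, and `f` is `G` plus an affine function.
  have hcv : ConvexOn ℝ I fun t => f t - G t := by
    refine convexOn_of_frequently_secondDiff hf.1 (hfc.sub hGc) fun x hx ε hε => ?_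
    refine tendsto_pow_half.frequently (Eventually.frequently ?_)
    filter_upwards [(hlim x hx).eventually (lt_mem_nhds (neg_neg_of_pos hε))] with n hn
    exact ((lt_div_iff₀ (hpos n)).mp hn).le
  have hcv' : ConvexOn ℝ I fun t => G t - f t := by
    refine convexOn_of_frequently_secondDiff hf.1 (hGc.sub hfc) fun x hx ε hε => ?_
    refine tendsto_pow_half.frequently (Eventually.frequently ?_)
    filter_upwards [(hlim x hx).eventually (gt_mem_nhds hε)] with n hn
    have := ((div_lt_iff₀ (hpos n)).mp hn).le
    rw [secondDiff_sub] at this ⊢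
    linarith
  obtain ⟨α, β, hαβ⟩ := exists_affine_of_convexOn_of_concaveOn hI hcv
    (by simpa [Pi.neg_def] using hcv'.neg)
  refine ⟨fun x => G' x + α, w, fun x hx => ?_, fun x hx => (hG' x hx).add_const α, hwc⟩
  have h1 : HasDerivAt (fun t => G t + (α * t + β)) (G' x + α) x := by
    exact ((hG x hx).add (((hasDerivAt_id x).const_mul α).add_const β)).congr_deriv (by simp)
  refine h1.congr_of_eventuallyEq ?_
  filter_upwards [hI.mem_nhds hx] with t ht
  linarith [hαβ t ht]

/-! ### Convex derivatives and the class `Q_2` -/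

/-- The trapezoid rule overestimates the integral of a convex function: the derivative of the
comparison function is the chord of `w` minus `w`. -/
lemma HasDerivAt.sub_le_of_convexOn {I : Set ℝ} {g w : ℝ → ℝ}
    (hg : ∀ x ∈ I, HasDerivAt g (w x) x) (hw : ConvexOn ℝ I w) {s t : ℝ} (hs : s ∈ I) (ht : t ∈ I)
    (hst : s < t) : g t - g s ≤ (w s + w t) / 2 * (t - s) := by
  have hsub : Icc s t ⊆ I := hw.1.ordConnected.out hs ht
  set m := (w t - w s) / (t - s) with hm
  have hmt : m * (t - s) = w t - w s := div_mul_cancel₀ _ (by linarith)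
  have hd : ∀ x ∈ I, HasDerivAt (fun x => w s * (x - s) + m * ((x - s) ^ 2 / 2) - g x)
      (w s + m * (x - s) - w x) x := by
    intro x hx
    have h1 : HasDerivAt (fun x => x - s) 1 x := (hasDerivAt_id x).sub_const s
    exact (((h1.const_mul (w s)).add (((h1.pow 2).div_const 2).const_mul m)).sub
      (hg x hx)).congr_deriv (by simp)
  have hmono : MonotoneOn (fun x => w s * (x - s) + m * ((x - s) ^ 2 / 2) - g x) (Icc s t) := by
    refine monotoneOn_of_deriv_nonneg (convex_Icc s t)
      (fun x hx => (hd x (hsub hx)).continuousAt.continuousWithinAt)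
      (fun x hx => (hd x (hsub (interior_subset hx))).differentiableAt.differentiableWithinAt) ?_
    intro x hx
    rw [(hd x (hsub (interior_subset hx))).deriv]
    rw [interior_Icc] at hx
    have hts : 0 < t - s := by linarith
    have ha : 0 ≤ (t - x) / (t - s) := div_nonneg (by linarith [hx.2]) hts.le
    have hb : 0 ≤ (x - s) / (t - s) := div_nonneg (by linarith [hx.1]) hts.le
    have := hw.2 hs ht ha hb (by field_simp; ring)
    have e : ((t - x) / (t - s)) • s + ((x - s) / (t - s)) • t = x := by
      simp only [smul_eq_mul]; field_simp; ring
    rw [e] at this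
    have e2 : ((t - x) / (t - s)) • w s + ((x - s) / (t - s)) • w t = w s + m * (x - s) := by
      simp only [smul_eq_mul, hm]; field_simp; ring
    rw [e2] at this
    linarith
  have := hmono (left_mem_Icc.mpr hst.le) (right_mem_Icc.mpr hst.le) hst.le
  simp only at this
  nlinarith

lemma dslope_comm (g : ℝ → ℝ) (s t : ℝ) : dslope g s t = dslope g t s := by
  rcases eq_or_ne s t with rfl | h
  · rfl
  · rw [dslope_of_ne _ h, dslope_of_ne _ h.symm, slope_comm]

lemma dslope_mul_sub (g : ℝ → ℝ) (s t : ℝ) : dslope g s t * (t - s) = g t - g s := by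
  simpa [mul_comm] using sub_smul_dslope g s t

/-- A function with convex derivative is in the class `Q_2`. -/
lemma mem_classQ_two_of_convexOn {I : Set ℝ} (hI : IsOpen I) {g w : ℝ → ℝ}
    (hg : ∀ x ∈ I, HasDerivAt g (w x) x) (hw : ConvexOn ℝ I w) : g ∈ ClassQ 2 I := by
  refine ⟨?_, fun l hl => ?_⟩
  · have h := (contDiffOn_succ_iff_deriv_of_isOpen (n := 0) (f := g) hI).mpr
      ⟨fun x hx => (hg x hx).differentiableAt.differentiableWithinAt, by simp, ?_⟩
    · simpa using h
    · exact contDiffOn_zero.mpr ((hw.continuousOn hI).congr fun x hx => (hg x hx).deriv)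
  · have hL : loewnerMatrix g l =
        symMat (w (l 0)) (dslope g (l 0) (l 1)) (w (l 1)) := by
      ext i j
      fin_cases i <;> fin_cases j <;>
        simp [loewnerMatrix, symMat, (hg _ (hl _)).deriv, dslope_comm g (l 1) (l 0)]
    have key : 2 * dslope g (l 0) (l 1) ≤ w (l 0) + w (l 1) := by
      rcases lt_trichotomy (l 0) (l 1) with h | h | h
      · have h1 := HasDerivAt.sub_le_of_convexOn hg hw (hl 0) (hl 1) h
        rw [← dslope_mul_sub] at h1
        have := le_of_mul_le_mul_right h1 (by linarith)
        linarith
      · rw [h, dslope_same, (hg _ (hl 1)).deriv]; linarith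
      · have h1 := HasDerivAt.sub_le_of_convexOn hg hw (hl 1) (hl 0) h
        rw [← dslope_mul_sub] at h1
        have := le_of_mul_le_mul_right h1 (by linarith)
        rw [dslope_comm]
        linarith
    rw [hL]
    refine ⟨symMat_isHermitian .., fun x hx => ?_⟩
    rw [Fin.sum_univ_two] at hx
    have hx1 : x 1 = -x 0 := by linear_combination hx
    rw [Complex.le_def]
    simp [symMat, Matrix.mulVec, dotProduct, Fin.sum_univ_two, hx1]
    constructor
    · nlinarith [mul_nonneg (sub_nonneg.mpr key)
        (add_nonneg (sq_nonneg (x 0).re) (sq_nonneg (x 0).im))]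
    · ring

/-- A matrix convex function of order two is differentiable, with derivative in the class `Q_2`. -/
lemma MatrixConvexOn.deriv_mem_classQ {I : Set ℝ} (hI : IsOpen I) (hc : Convex ℝ I) {f : ℝ → ℝ}
    (h : MatrixConvexOn 2 I f) : DifferentiableOn ℝ f I ∧ deriv f ∈ ClassQ 2 I := by
  have hf := h.convexOn hc
  obtain ⟨g, w, hg, hw, hwc⟩ := exists_deriv_deriv_of_fourth_diff hI hf fun x δ hδ h1 h2 =>
    secondDiff_secondDiff_nonneg hI hc (hf.continuousOn hI) (fun x δ hδ h1 h2 =>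
      h.symmetric_sum_ineq hδ h1 (hc.ordConnected.out h2 h1 ⟨by linarith, by linarith⟩) h2
        (hc.ordConnected.out h2 h1 ⟨by linarith, by linarith⟩)) hδ h1 h2
  refine ⟨fun x hx => (hg x hx).differentiableAt.differentiableWithinAt,
    mem_classQ_two_of_convexOn hI (fun x hx => ?_) hwc⟩
  refine (hw x hx).congr_of_eventuallyEq ?_
  filter_upwards [hI.mem_nhds hx] with t ht
  exact (hg t ht).deriv

/-! ### Matrix convexity from interpolation errors -/

/-- The spectral decomposition of a Hermitian matrix in an orthonormal basis. -/
lemma Matrix.IsHermitian.exists_unitary_conj_cfc {n : ℕ} {X : Matrix (Fin n) (Fin n) ℂ}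
    (hX : X.IsHermitian) (U : Matrix (Fin n) (Fin n) ℂ) (hU : U.conjTranspose * U = 1) :
    ∃ (W : Matrix (Fin n) (Fin n) ℂ) (μ : Fin n → ℝ), W * W.conjTranspose = 1 ∧
      (∀ i, μ i ∈ spectrum ℝ X) ∧ ∀ f : ℝ → ℝ, U.conjTranspose * cfc f X * U =
        W * Matrix.diagonal (fun i => ((f (μ i) : ℝ) : ℂ)) * W.conjTranspose := by
  set V : Matrix (Fin n) (Fin n) ℂ := hX.eigenvectorUnitary.1 with hV
  have hV1 : V * V.conjTranspose = 1 := Unitary.mul_star_self_of_mem hX.eigenvectorUnitary.2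
  refine ⟨U.conjTranspose * V, hX.eigenvalues, ?_, hX.eigenvalues_mem_spectrum_real, fun f => ?_⟩
  · rw [Matrix.conjTranspose_mul, Matrix.conjTranspose_conjTranspose, Matrix.mul_assoc,
      ← Matrix.mul_assoc V, hV1, Matrix.one_mul, hU]
  · rw [hX.cfc_eq, Matrix.IsHermitian.cfc, Unitary.conjStarAlgAut_apply, Matrix.conjTranspose_mul,
      Matrix.conjTranspose_conjTranspose]
    simp only [Matrix.mul_assoc]
    rfl

lemma mul_diagonal_mul_conjTranspose_apply {n : ℕ} (W : Matrix (Fin n) (Fin n) ℂ) (d : Fin n → ℂ)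
    (i k : Fin n) : (W * Matrix.diagonal d * W.conjTranspose) i k =
      ∑ j, d j * (W i j * star (W k j)) := by
  rw [Matrix.mul_apply]
  refine Finset.sum_congr rfl fun j _ => ?_
  rw [Matrix.mul_diagonal, Matrix.conjTranspose_apply]
  ring

/-- The matrix of errors at `m` of the interpolations of `f` at pairs of nodes from `l`. -/
noncomputable def interpolationError {n : ℕ} (f : ℝ → ℝ) (l : Fin n → ℝ) (m : ℝ) :
    Matrix (Fin n) (Fin n) ℂ :=
  Matrix.of fun i k => ((f m - f (l i) - dslope f (l i) (l k) * (m - l i) : ℝ) : ℂ)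

/-- The term linear in `μ j` is the part that cancels when the contributions of two matrices are
averaged to a diagonal one. -/
lemma sum_interpolationError {n : ℕ} (f : ℝ → ℝ) (l μ : Fin n → ℝ)
    {W : Matrix (Fin n) (Fin n) ℂ} (hW : W * W.conjTranspose = 1) (i k : Fin n) :
    (∑ j, Matrix.diagonal (fun i => W i j) * interpolationError f l (μ j) *
      (Matrix.diagonal (fun i => W i j)).conjTranspose) i k =
    (W * Matrix.diagonal (fun i => ((f (μ i) : ℝ) : ℂ)) * W.conjTranspose) i k -
      (f (l i) : ℂ) * (1 : Matrix (Fin n) (Fin n) ℂ) i k - ((dslope f (l i) (l k) : ℝ) : ℂ) *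
      ((W * Matrix.diagonal (fun i => ((μ i : ℝ) : ℂ)) * W.conjTranspose) i k -
        (l i : ℂ) * (1 : Matrix (Fin n) (Fin n) ℂ) i k) := by
  have h1 : (1 : Matrix (Fin n) (Fin n) ℂ) i k = ∑ j, W i j * star (W k j) := by
    rw [← hW, Matrix.mul_apply]; rfl
  rw [mul_diagonal_mul_conjTranspose_apply, mul_diagonal_mul_conjTranspose_apply, h1,
    Matrix.sum_apply, Finset.mul_sum, Finset.mul_sum, ← Finset.sum_sub_distrib,
    ← Finset.sum_sub_distrib, Finset.mul_sum, ← Finset.sum_sub_distrib]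
  refine Finset.sum_congr rfl fun j _ => ?_
  rw [Matrix.diagonal_conjTranspose, Matrix.mul_diagonal, Matrix.diagonal_mul]
  simp only [interpolationError, Matrix.of_apply, Pi.star_apply]
  push_cast
  ring

/-- A function is matrix convex if its matrices of interpolation errors are positive. -/
lemma matrixConvexOn_of_interpolationError {n : ℕ} {I : Set ℝ} (hI : Convex ℝ I) {f : ℝ → ℝ}
    (h : ∀ l : Fin n → ℝ, (∀ i, l i ∈ I) → ∀ m ∈ I, (interpolationError f l m).PosSemidef) :
    MatrixConvexOn n I f := by
  intro A B hA hB sA sB c hc0 hc1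
  have hc1' : 0 ≤ 1 - c := by linarith
  set C := c • A + (1 - c) • B with hCdef
  have hsA : IsSelfAdjoint A := hA
  have hsB : IsSelfAdjoint B := hB
  have hC : C.IsHermitian :=
    ((IsSelfAdjoint.all c).smul hsA).add ((IsSelfAdjoint.all (1 - c)).smul hsB)
  have hsC : IsSelfAdjoint C := hC
  set U : Matrix (Fin n) (Fin n) ℂ := hC.eigenvectorUnitary.1 with hU
  have hU1 : U.conjTranspose * U = 1 := Unitary.star_mul_self_of_mem hC.eigenvectorUnitary.2
  have hU2 : U * U.conjTranspose = 1 := Unitary.mul_star_self_of_mem hC.eigenvectorUnitary.2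
  set l := hC.eigenvalues with hl
  have hCf : ∀ f : ℝ → ℝ,
      U.conjTranspose * cfc f C * U = Matrix.diagonal (fun i => ((f (l i) : ℝ) : ℂ)) := by
    intro f
    rw [hC.cfc_eq, Matrix.IsHermitian.cfc, Unitary.conjStarAlgAut_apply]
    change U.conjTranspose * (U * Matrix.diagonal (fun i => ((f (l i) : ℝ) : ℂ)) *
      U.conjTranspose) * U = _
    rw [Matrix.mul_assoc, Matrix.mul_assoc _ U.conjTranspose U, hU1, Matrix.mul_one,
      ← Matrix.mul_assoc, hU1, Matrix.one_mul]
  obtain ⟨V, μ, hV, hμ, hAf⟩ := hA.exists_unitary_conj_cfc U hU1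
  obtain ⟨W, ν, hW, hν, hBf⟩ := hB.exists_unitary_conj_cfc U hU1
  have hCid := hCf id
  have hAid := hAf id
  have hBid := hBf id
  rw [cfc_id ℝ A] at hAid
  rw [cfc_id ℝ B] at hBid
  rw [cfc_id ℝ C] at hCid
  simp only [id] at hCid hAid hBid
  have hlin : ∀ X Y Z : Matrix (Fin n) (Fin n) ℂ, U.conjTranspose * (c • X + (1 - c) • Y - Z) * U =
      c • (U.conjTranspose * X * U) + (1 - c) • (U.conjTranspose * Y * U) -
        U.conjTranspose * Z * U := by
    intro X Y Z
    simp only [Matrix.mul_sub, Matrix.sub_mul, Matrix.mul_add, Matrix.add_mul, Matrix.mul_smul,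
      Matrix.smul_mul]
  have hzero := hlin A B C
  rw [← hCdef, sub_self, Matrix.mul_zero, Matrix.zero_mul, hAid, hBid, hCid] at hzero
  have hent : ∀ i k, (c : ℂ) *
      (V * Matrix.diagonal (fun i => ((μ i : ℝ) : ℂ)) * V.conjTranspose) i k +
      (1 - c : ℂ) * (W * Matrix.diagonal (fun i => ((ν i : ℝ) : ℂ)) * W.conjTranspose) i k =
      (l i : ℂ) * (1 : Matrix (Fin n) (Fin n) ℂ) i k := by
    intro i k
    have := congrFun (congrFun hzero i) k
    simp only [Matrix.zero_apply, Matrix.sub_apply, Matrix.add_apply, Matrix.smul_apply,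
      Complex.real_smul, Matrix.diagonal_apply] at this
    rw [Matrix.one_apply]
    push_cast at this
    split_ifs at this ⊢ <;> linear_combination -this
  -- An eigenvalue of `C` is a diagonal entry in its eigenbasis, hence a convex combination of
  -- eigenvalues of `A` and `B`: the rows of `V` and `W` are unit vectors.
  have hlI : ∀ i, l i ∈ I := by
    intro i
    have hsum : ∀ Z : Matrix (Fin n) (Fin n) ℂ, Z * Z.conjTranspose = 1 →
        ∑ j, ‖Z i j‖ ^ 2 = 1 := by
      intro Z hZ
      have := congrFun (congrFun hZ i) i
      rw [Matrix.mul_apply, Matrix.one_apply_eq] at this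
      simp only [Matrix.conjTranspose_apply, RCLike.star_def, Complex.mul_conj'] at this
      exact_mod_cast this
    have hI1 : ∀ (Z : Matrix (Fin n) (Fin n) ℂ) (κ : Fin n → ℝ), Z * Z.conjTranspose = 1 →
        (∀ j, κ j ∈ I) → ∑ j, ‖Z i j‖ ^ 2 • κ j ∈ I := fun Z κ hZ hκ =>
      hI.sum_mem (fun j _ => sq_nonneg _) (hsum Z hZ) fun j _ => hκ j
    have h1 := hI (hI1 V μ hV fun j => sA (hμ j)) (hI1 W ν hW fun j => sB (hν j)) hc0 hc1'
      (by ring)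
    convert h1 using 1
    have := hent i i
    rw [mul_diagonal_mul_conjTranspose_apply, mul_diagonal_mul_conjTranspose_apply,
      Matrix.one_apply_eq, mul_one] at this
    simp only [RCLike.star_def, Complex.mul_conj'] at this
    apply Complex.ofReal_injective
    rw [← this]
    simp only [smul_eq_mul]
    push_cast
    simp only [mul_comm]
  have hM : U.conjTranspose * (c • cfc f A + (1 - c) • cfc f B - cfc f C) * U =
      c • (∑ j, Matrix.diagonal (fun i => V i j) * interpolationError f l (μ j) *
        (Matrix.diagonal (fun i => V i j)).conjTranspose) +
      (1 - c) • (∑ j, Matrix.diagonal (fun i => W i j) * interpolationError f l (ν j) *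
        (Matrix.diagonal (fun i => W i j)).conjTranspose) := by
    rw [hlin, hAf, hBf, hCf]
    ext i k
    simp only [Matrix.sub_apply, Matrix.add_apply, Matrix.smul_apply, Complex.real_smul]
    rw [sum_interpolationError f l μ hV, sum_interpolationError f l ν hW]
    have h1 := hent i k
    have h2 : Matrix.diagonal (fun i => ((f (l i) : ℝ) : ℂ)) i k =
        (f (l i) : ℂ) * (1 : Matrix (Fin n) (Fin n) ℂ) i k := by
      rw [Matrix.diagonal_apply, Matrix.one_apply]
      split_ifs <;> simp
    rw [h2]
    push_cast
    linear_combination ((dslope f (l i) (l k) : ℝ) : ℂ) * h1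
  have hpsd : (U.conjTranspose * (c • cfc f A + (1 - c) • cfc f B - cfc f C) * U).PosSemidef := by
    rw [hM]
    refine Matrix.PosSemidef.add (Matrix.PosSemidef.smul ?_ hc0) (Matrix.PosSemidef.smul ?_ hc1')
    · exact Matrix.posSemidef_sum _ fun j _ =>
        (h l hlI _ (sA (hμ j))).mul_mul_conjTranspose_same _
    · exact Matrix.posSemidef_sum _ fun j _ =>
        (h l hlI _ (sB (hν j))).mul_mul_conjTranspose_same _
  have := hpsd.mul_mul_conjTranspose_same U
  rwa [← Matrix.mul_assoc, ← Matrix.mul_assoc, hU2, Matrix.one_mul, Matrix.mul_assoc, hU2,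
    Matrix.mul_one] at this

/-! ### Rank-one perturbations and Loewner forms -/

/-- The difference of the eigenvalues of `symMat (p + ε a²) (ε a b) (p + Δ + ε b²)`. -/
noncomputable def eigenGap (Δ a b ε : ℝ) : ℝ :=
  √((Δ + ε * (b ^ 2 - a ^ 2)) ^ 2 + (2 * ε * a * b) ^ 2)

/-- The displacement of the lower eigenvalue under a perturbation of rank one. -/
noncomputable def lowerShift (Δ a b ε : ℝ) : ℝ := (Δ + ε * (a ^ 2 + b ^ 2) - eigenGap Δ a b ε) / 2

/-- The displacement of the upper eigenvalue under a perturbation of rank one. -/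
noncomputable def upperShift (Δ a b ε : ℝ) : ℝ := (-Δ + ε * (a ^ 2 + b ^ 2) + eigenGap Δ a b ε) / 2

/-- The increment of the quadratic form of `G` at the vector `(1, 1)` when `diag (p, p + Δ)` is
perturbed by the matrix of rank one `ε (a, b) (a, b)ᵀ`. -/
noncomputable def formIncrement (G : ℝ → ℝ) (Δ a b ε p : ℝ) : ℝ :=
  (1 - 2 * ε * a * b / eigenGap Δ a b ε) * G (p + lowerShift Δ a b ε) +
    (1 + 2 * ε * a * b / eigenGap Δ a b ε) * G (p + Δ + upperShift Δ a b ε) - G p - G (p + Δ)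

lemma eigenGap_sq (Δ a b ε : ℝ) :
    eigenGap Δ a b ε ^ 2 = (Δ + ε * (b ^ 2 - a ^ 2)) ^ 2 + (2 * ε * a * b) ^ 2 :=
  Real.sq_sqrt (by positivity)

lemma eigenGap_zero {Δ : ℝ} (hΔ : 0 < Δ) (a b : ℝ) : eigenGap Δ a b 0 = Δ := by
  simp [eigenGap, Real.sqrt_sq hΔ.le]

lemma hasDerivAt_eigenGap {Δ : ℝ} (hΔ : 0 < Δ) (a b : ℝ) :
    HasDerivAt (eigenGap Δ a b) (b ^ 2 - a ^ 2) 0 := by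
  have h1 : HasDerivAt (fun ε : ℝ => Δ + ε * (b ^ 2 - a ^ 2)) (b ^ 2 - a ^ 2) 0 := by
    simpa using ((hasDerivAt_id (0 : ℝ)).mul_const (b ^ 2 - a ^ 2)).const_add Δ
  have h2 : HasDerivAt (fun ε : ℝ => 2 * ε * a * b) (2 * a * b) 0 := by
    simpa using (((hasDerivAt_id (0 : ℝ)).const_mul 2).mul_const a).mul_const b
  refine (((h1.pow 2).add (h2.pow 2)).sqrt ?_).congr_deriv ?_
  · simp [hΔ.ne']
  · simp [Real.sqrt_sq hΔ.le]
    field_simp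

lemma hasDerivAt_lowerShift {Δ : ℝ} (hΔ : 0 < Δ) (a b : ℝ) :
    HasDerivAt (lowerShift Δ a b) (a ^ 2) 0 :=
  (((((hasDerivAt_id (0 : ℝ)).mul_const (a ^ 2 + b ^ 2)).const_add Δ).sub
    (hasDerivAt_eigenGap hΔ a b)).div_const 2).congr_deriv (by ring)

lemma hasDerivAt_upperShift {Δ : ℝ} (hΔ : 0 < Δ) (a b : ℝ) :
    HasDerivAt (upperShift Δ a b) (b ^ 2) 0 :=
  (((((hasDerivAt_id (0 : ℝ)).mul_const (a ^ 2 + b ^ 2)).const_add (-Δ)).add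
    (hasDerivAt_eigenGap hΔ a b)).div_const 2).congr_deriv (by ring)

lemma lowerShift_zero {Δ : ℝ} (hΔ : 0 < Δ) (a b : ℝ) : lowerShift Δ a b 0 = 0 := by
  simp [lowerShift, eigenGap_zero hΔ]

lemma upperShift_zero {Δ : ℝ} (hΔ : 0 < Δ) (a b : ℝ) : upperShift Δ a b 0 = 0 := by
  simp [upperShift, eigenGap_zero hΔ]

/-- First-order perturbation multiplies the direction entrywise by the Loewner matrix, so testing `ε
(a, b)(a, b)ᵀ` at `(1, 1)` gives the Loewner form at `(a, b)`. -/
lemma hasDerivAt_formIncrement {G : ℝ → ℝ} {Δ p G₁ G₂ : ℝ} (hΔ : 0 < Δ) (h1 : HasDerivAt G G₁ p)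
    (h2 : HasDerivAt G G₂ (p + Δ)) (a b : ℝ) :
    HasDerivAt (fun ε => formIncrement G Δ a b ε p)
      (a ^ 2 * G₁ + b ^ 2 * G₂ + 2 * a * b * ((G (p + Δ) - G p) / Δ)) 0 := by
  have hn : HasDerivAt (fun ε : ℝ => 2 * ε * a * b) (2 * a * b) 0 := by
    simpa using (((hasDerivAt_id (0 : ℝ)).const_mul 2).mul_const a).mul_const b
  have hκ : HasDerivAt (fun ε => 2 * ε * a * b / eigenGap Δ a b ε) (2 * a * b / Δ) 0 := by
    refine (hn.div (hasDerivAt_eigenGap hΔ a b) ?_).congr_deriv ?_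
    · rw [eigenGap_zero hΔ]; exact hΔ.ne'
    · rw [eigenGap_zero hΔ]
      field_simp
      ring
  have hl : HasDerivAt (fun ε => G (p + lowerShift Δ a b ε)) (G₁ * a ^ 2) 0 := by
    refine HasDerivAt.comp (0 : ℝ) (h₂ := G) ?_ ((hasDerivAt_lowerShift hΔ a b).const_add p)
    rwa [lowerShift_zero hΔ, add_zero]
  have hu : HasDerivAt (fun ε => G (p + Δ + upperShift Δ a b ε)) (G₂ * b ^ 2) 0 := by
    refine HasDerivAt.comp (0 : ℝ) (h₂ := G) ?_ ((hasDerivAt_upperShift hΔ a b).const_add (p + Δ))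
    rwa [upperShift_zero hΔ, add_zero]
  refine (((((hκ.const_sub 1).mul hl).add ((hκ.const_add 1).mul hu)).sub_const _).sub_const
    _).congr_deriv ?_
  simp only [lowerShift_zero hΔ, upperShift_zero hΔ]
  ring_nf

lemma formIncrement_zero {Δ : ℝ} (hΔ : 0 < Δ) (G : ℝ → ℝ) (a b p : ℝ) :
    formIncrement G Δ a b 0 p = 0 := by
  simp [formIncrement, lowerShift_zero hΔ, upperShift_zero hΔ]

lemma loewner_form_nonneg_of_formIncrement {G : ℝ → ℝ} {Δ p G₁ G₂ : ℝ} (hΔ : 0 < Δ)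
    (h1 : HasDerivAt G G₁ p) (h2 : HasDerivAt G G₂ (p + Δ)) {a b : ℝ}
    (h : ∀ᶠ ε in 𝓝[>] (0 : ℝ), 0 ≤ formIncrement G Δ a b ε p) :
    0 ≤ a ^ 2 * G₁ + b ^ 2 * G₂ + 2 * a * b * ((G (p + Δ) - G p) / Δ) := by
  have hle : 𝓝[>] (0 : ℝ) ≤ 𝓝[≠] 0 := nhdsWithin_mono _ fun y hy => ne_of_gt hy
  have hs := (hasDerivAt_iff_tendsto_slope_zero.mp
    (hasDerivAt_formIncrement hΔ h1 h2 a b)).mono_left hle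
  refine ge_of_tendsto hs ?_
  filter_upwards [h, self_mem_nhdsWithin] with ε h3 h4
  have : (0 : ℝ) < ε := h4
  rw [formIncrement_zero hΔ, zero_add, sub_zero, smul_eq_mul]
  positivity

lemma MatrixMonotoneOn.formIncrement_nonneg {I : Set ℝ} {g : ℝ → ℝ} (hg : MatrixMonotoneOn 2 I g)
    {Δ a b ε p : ℝ} (hΔ : 0 < Δ) (hε : 0 ≤ ε) (hr : eigenGap Δ a b ε ≠ 0) (h1 : p ∈ I)
    (h2 : p + Δ ∈ I) (h3 : p + lowerShift Δ a b ε ∈ I) (h4 : p + Δ + upperShift Δ a b ε ∈ I) :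
    0 ≤ formIncrement g Δ a b ε p := by
  have e1 : p + (p + Δ) = p + (p + Δ) := rfl
  have e2 : p * (p + Δ) = p * (p + Δ) - 0 ^ 2 := by ring
  have e3 : p + lowerShift Δ a b ε + (p + Δ + upperShift Δ a b ε) =
      p + ε * a ^ 2 + (p + Δ + ε * b ^ 2) := by
    unfold lowerShift upperShift; ring
  have e4 : (p + lowerShift Δ a b ε) * (p + Δ + upperShift Δ a b ε) =
      (p + ε * a ^ 2) * (p + Δ + ε * b ^ 2) - (ε * a * b) ^ 2 := by
    unfold lowerShift upperShift
    linear_combination (-1 / 4) * eigenGap_sq Δ a b ε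
  have e5 : p + Δ + upperShift Δ a b ε - (p + lowerShift Δ a b ε) = eigenGap Δ a b ε := by
    unfold lowerShift upperShift; ring
  have n1 : p ≠ p + Δ := by linarith
  have n2 : p + lowerShift Δ a b ε ≠ p + Δ + upperShift Δ a b ε := by
    intro h; exact hr (by rw [← e5, h, sub_self])
  have key := hg (symMat p 0 (p + Δ)) (symMat (p + ε * a ^ 2) (ε * a * b) (p + Δ + ε * b ^ 2))
    (symMat_isHermitian ..) (symMat_isHermitian ..)
    ((spectrum_symMat_subset e1 e2).trans (by rintro y (rfl | rfl) <;> assumption))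
    ((spectrum_symMat_subset e3 e4).trans (by rintro y (rfl | rfl) <;> assumption)) (by
      rw [symMat_sub]
      refine posSemidef_symMat fun s t => ?_
      have : s ^ 2 * (p + ε * a ^ 2 - p) + 2 * s * t * (ε * a * b - 0) +
        t ^ 2 * (p + Δ + ε * b ^ 2 - (p + Δ)) = ε * (s * a + t * b) ^ 2 := by ring
      rw [this]
      positivity)
  rw [cfc_symMat g n1 e1 e2, cfc_symMat g n2 e3 e4, symMat_sub] at key
  have h := key.symMat_form_nonneg 1 1
  rw [e5] at h
  refine h.trans_eq ?_
  unfold formIncrement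
  set u := g (p + lowerShift Δ a b ε)
  set v := g (p + Δ + upperShift Δ a b ε)
  have hΔ' := hΔ.ne'
  have e6 : p + Δ - p = Δ := by ring
  rw [e6]
  unfold lowerShift upperShift
  set r := eigenGap Δ a b ε
  field_simp
  ring

lemma MatrixMonotoneOn.loewner_form_nonneg {I : Set ℝ} (hI : IsOpen I) {g : ℝ → ℝ}
    (hg : MatrixMonotoneOn 2 I g) {Δ p G₁ G₂ : ℝ} (hΔ : 0 < Δ) (hp : p ∈ I) (hq : p + Δ ∈ I)
    (h1 : HasDerivAt g G₁ p) (h2 : HasDerivAt g G₂ (p + Δ)) (a b : ℝ) :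
    0 ≤ a ^ 2 * G₁ + b ^ 2 * G₂ + 2 * a * b * ((g (p + Δ) - g p) / Δ) := by
  refine loewner_form_nonneg_of_formIncrement hΔ h1 h2 ?_
  have c1 : ContinuousAt (fun ε => p + lowerShift Δ a b ε) 0 :=
    ((hasDerivAt_lowerShift hΔ a b).const_add p).continuousAt
  have c2 : ContinuousAt (fun ε => p + Δ + upperShift Δ a b ε) 0 :=
    ((hasDerivAt_upperShift hΔ a b).const_add (p + Δ)).continuousAt
  have m1 := c1.eventually_mem (hI.mem_nhds (by simpa [lowerShift_zero hΔ] using hp))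
  have m2 := c2.eventually_mem (hI.mem_nhds (by simpa [upperShift_zero hΔ] using hq))
  have m3 := (hasDerivAt_eigenGap hΔ a b).continuousAt.eventually_ne
    (show eigenGap Δ a b 0 ≠ 0 by rw [eigenGap_zero hΔ]; exact hΔ.ne')
  filter_upwards [m1.filter_mono nhdsWithin_le_nhds, m2.filter_mono nhdsWithin_le_nhds,
    m3.filter_mono nhdsWithin_le_nhds, self_mem_nhdsWithin] with ε k1 k2 k3 k4
  exact hg.formIncrement_nonneg hΔ (le_of_lt k4) k3 hp hq k1 k2

/-- If the derivative of `f` is matrix monotone, the difference quotients of `f` satisfy the same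
inequality. -/
lemma MatrixMonotoneOn.formIncrement_diffQuot_nonneg {I : Set ℝ} (hc : Convex ℝ I) {f g : ℝ → ℝ}
    (hf : ∀ x ∈ I, HasDerivAt f (g x) x) (hg : MatrixMonotoneOn 2 I g)
    {Δ a b ε p h : ℝ} (hh : 0 < h) (hΔ : 0 < Δ) (hε : 0 ≤ ε) (hr : eigenGap Δ a b ε ≠ 0)
    (h1 : p ∈ I) (h2 : p + Δ ∈ I) (h3 : p + lowerShift Δ a b ε ∈ I)
    (h4 : p + Δ + upperShift Δ a b ε ∈ I) (h1' : p + h ∈ I) (h2' : p + Δ + h ∈ I)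
    (h3' : p + lowerShift Δ a b ε + h ∈ I) (h4' : p + Δ + upperShift Δ a b ε + h ∈ I) :
    0 ≤ formIncrement (fun x => (f (x + h) - f x) / h) Δ a b ε p := by
  have hin : ∀ {z : ℝ}, z ∈ I → z + h ∈ I → ∀ y ∈ Icc 0 h, z + y ∈ I := fun hz hz' y hy =>
    hc.ordConnected.out hz hz' ⟨by linarith [hy.1], by linarith [hy.2]⟩
  set κ := 2 * ε * a * b / eigenGap Δ a b ε with hκ
  set s := lowerShift Δ a b ε with hs
  set t := upperShift Δ a b ε with ht
  -- The weights and eigenvalue shifts do not depend on the base point, so differentiating in a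
  -- translation `y` just replaces `f` by `g`.
  have hd : ∀ y ∈ Icc 0 h, HasDerivAt (fun y => (1 - κ) * f (p + s + y) +
      (1 + κ) * f (p + Δ + t + y) - f (p + y) - f (p + Δ + y))
      (formIncrement g Δ a b ε (p + y)) y := by
    intro y hy
    have d1 := (hf _ (hin h3 h3' y hy)).comp_const_add (p + s) y
    have d2 := (hf _ (hin h4 h4' y hy)).comp_const_add (p + Δ + t) y
    have d3 := (hf _ (hin h1 h1' y hy)).comp_const_add p y
    have d4 := (hf _ (hin h2 h2' y hy)).comp_const_add (p + Δ) y
    refine ((((d1.const_mul (1 - κ)).add (d2.const_mul (1 + κ))).sub d3).sub d4).congr_deriv ?_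
    unfold formIncrement
    rw [← hκ, ← hs, ← ht, show p + y + s = p + s + y by ring,
      show p + y + Δ = p + Δ + y by ring, show p + Δ + y + t = p + Δ + t + y by ring]
  have hmono := monotoneOn_of_deriv_nonneg (convex_Icc 0 h)
    (fun y hy => (hd y hy).continuousAt.continuousWithinAt)
    (fun y hy => (hd y (interior_subset hy)).differentiableAt.differentiableWithinAt)
    (fun y hy => by
      have hy' := interior_subset hy
      rw [(hd y hy').deriv]
      refine hg.formIncrement_nonneg hΔ hε hr (hin h1 h1' y hy') ?_ ?_ ?_
      · rw [show p + y + Δ = p + Δ + y by ring]; exact hin h2 h2' y hy'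
      · rw [← hs, show p + y + s = p + s + y by ring]; exact hin h3 h3' y hy'
      · rw [← ht, show p + y + Δ + t = p + Δ + t + y by ring]; exact hin h4 h4' y hy')
  have := hmono (left_mem_Icc.mpr hh.le) (right_mem_Icc.mpr hh.le) hh.le
  simp only [add_zero] at this
  unfold formIncrement
  rw [← hκ, ← hs, ← ht]
  have e : (1 - κ) * ((f (p + s + h) - f (p + s)) / h) +
      (1 + κ) * ((f (p + Δ + t + h) - f (p + Δ + t)) / h) - (f (p + h) - f p) / h -
      (f (p + Δ + h) - f (p + Δ)) / h =
      (((1 - κ) * f (p + s + h) + (1 + κ) * f (p + Δ + t + h) - f (p + h) - f (p + Δ + h)) -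
      ((1 - κ) * f (p + s) + (1 + κ) * f (p + Δ + t) - f p - f (p + Δ))) / h := by ring
  rw [e]
  exact div_nonneg (by linarith) hh.le

/-! ### From Loewner forms to interpolation errors -/

/-- If the Loewner matrices of order two of `φ'` are positive, so are the matrices of interpolation
errors of `φ`. -/
lemma interpolation_form_nonneg_of_loewner {J : Set ℝ} (hJ : Convex ℝ J) {φ γ ω : ℝ → ℝ}
    (hφ : ∀ x ∈ J, HasDerivAt φ (γ x) x) (hγ : ∀ x ∈ J, HasDerivAt γ (ω x) x)
    (hL : ∀ p Δ : ℝ, 0 < Δ → p ∈ J → p + Δ ∈ J → ∀ a b : ℝ,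
      0 ≤ a ^ 2 * ω p + b ^ 2 * ω (p + Δ) + 2 * a * b * ((γ (p + Δ) - γ p) / Δ))
    {k l m : ℝ} (hkl : k < l) (hk : k ∈ J) (hl : l ∈ J) (hm : m ∈ J) (a b : ℝ) :
    0 ≤ a ^ 2 * (φ m - φ k - γ k * (m - k)) +
      2 * a * b * (φ m - φ k - (φ l - φ k) / (l - k) * (m - k)) +
      b ^ 2 * (φ m - φ l - γ l * (m - l)) := by
  have hlk : l - k ≠ 0 := by linarith
  have hin : ∀ {z : ℝ}, z ∈ J → ∀ t ∈ Icc (0 : ℝ) 1, m + t * (z - m) ∈ J := fun {z} hz t ht => by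
    have := hJ hm hz (sub_nonneg.mpr ht.2) ht.1 (by ring)
    convert this using 1
    simp only [smul_eq_mul]; ring
  set u := (l - m) / (l - k) with hu
  set v := (m - k) / (l - k) with hv
  -- The error form with nodes contracted toward `m` by the factor `t`. The barycentric weights `u`,
  -- `v` of `m` are unchanged by this, and `Q 0 = 0`.
  set Q : ℝ → ℝ := fun t =>
    a ^ 2 * (φ m - φ (m + t * (k - m)) - γ (m + t * (k - m)) * (m - (m + t * (k - m)))) +
    2 * a * b * (φ m - u * φ (m + t * (k - m)) - v * φ (m + t * (l - m))) +
    b ^ 2 * (φ m - φ (m + t * (l - m)) - γ (m + t * (l - m)) * (m - (m + t * (l - m)))) with hQ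
  have hd : ∀ t ∈ Icc (0 : ℝ) 1, HasDerivAt Q
      (a ^ 2 * (ω (m + t * (k - m)) * (k - m) ^ 2 * t) +
      2 * a * b * ((k - m) * (l - m) * (γ (m + t * (l - m)) - γ (m + t * (k - m))) / (l - k)) +
      b ^ 2 * (ω (m + t * (l - m)) * (l - m) ^ 2 * t)) t := by
    intro t ht
    have hline : ∀ z : ℝ, HasDerivAt (fun t => m + t * (z - m)) (z - m) t := fun z =>
      (((hasDerivAt_id t).mul_const (z - m)).const_add m).congr_deriv (by simp)
    have dφ : ∀ z ∈ J, HasDerivAt (fun t => φ (m + t * (z - m)))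
        (γ (m + t * (z - m)) * (z - m)) t := fun z hz =>
      HasDerivAt.comp t (h₂ := φ) (hφ _ (hin hz t ht)) (hline z)
    have dγ : ∀ z ∈ J, HasDerivAt (fun t => γ (m + t * (z - m)))
        (ω (m + t * (z - m)) * (z - m)) t := fun z hz =>
      HasDerivAt.comp t (h₂ := γ) (hγ _ (hin hz t ht)) (hline z)
    have dT : ∀ z ∈ J, HasDerivAt (fun t => φ m - φ (m + t * (z - m)) -
        γ (m + t * (z - m)) * (m - (m + t * (z - m)))) (ω (m + t * (z - m)) * (z - m) ^ 2 * t) t :=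
      fun z hz => (((dφ z hz).const_sub (φ m)).sub
        ((dγ z hz).mul ((hline z).const_sub m))).congr_deriv (by ring)
    refine ((((dT k hk).const_mul (a ^ 2)).add (((((dφ k hk).const_mul u).const_sub (φ m)).sub
      ((dφ l hl).const_mul v)).const_mul (2 * a * b))).add
      ((dT l hl).const_mul (b ^ 2))).congr_deriv ?_
    rw [hu, hv]
    field_simp
    ring
  have hmono : MonotoneOn Q (Icc 0 1) := by
    refine monotoneOn_of_deriv_nonneg (convex_Icc 0 1)
      (fun t ht => (hd t ht).continuousAt.continuousWithinAt)
      (fun t ht => (hd t (interior_subset ht)).differentiableAt.differentiableWithinAt)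
      fun t ht => ?_
    have ht' := interior_subset ht
    rw [interior_Icc] at ht
    rw [(hd t ht').deriv]
    have ht0 : 0 < t := ht.1
    have hkl' : 0 < l - k := by linarith
    have e : m + t * (k - m) + t * (l - k) = m + t * (l - m) := by ring
    -- With this rescaled vector, `t` times the Loewner form is the derivative of `Q`.
    have := hL (m + t * (k - m)) (t * (l - k)) (by positivity) (hin hk t ht')
      (by rw [e]; exact hin hl t ht') (a * (k - m)) (b * (l - m))
    rw [e] at this
    refine (mul_nonneg ht0.le this).trans_eq ?_
    field_simp
    ring
  have h01 := hmono (left_mem_Icc.mpr zero_le_one) (right_mem_Icc.mpr zero_le_one) zero_le_one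
  have huv : u + v = 1 := by rw [hu, hv]; field_simp; ring
  have h0 : Q 0 = 0 := by
    simp only [hQ, zero_mul, add_zero, sub_self, mul_zero]
    linear_combination -2 * a * b * φ m * huv
  rw [h0] at h01
  refine h01.trans_eq ?_
  simp only [hQ, one_mul, add_sub_cancel]
  have e1 : (φ l - φ k) / (l - k) * (m - k) = (φ l - φ k) * v := by rw [hv]; ring
  rw [e1]
  linear_combination -2 * a * b * φ k * huv

lemma tendsto_diffQuot {f : ℝ → ℝ} {f' x : ℝ} (hf : HasDerivAt f f' x) :
    Tendsto (fun h => (f (x + h) - f x) / h) (𝓝[>] 0) (𝓝 f') := by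
  have h1 := (hasDerivAt_iff_tendsto_slope_zero.mp hf).mono_left
    (nhdsWithin_mono _ fun y (hy : (0 : ℝ) < y) => ne_of_gt hy)
  refine h1.congr fun h => ?_
  rw [smul_eq_mul, inv_mul_eq_div]

lemma hasDerivAt_diffQuot {f f' : ℝ → ℝ} {x h : ℝ} (h1 : HasDerivAt f (f' x) x)
    (h2 : HasDerivAt f (f' (x + h)) (x + h)) :
    HasDerivAt (fun y => (f (y + h) - f y) / h) ((f' (x + h) - f' x) / h) x :=
  ((h2.comp_add_const x h).sub h1).div_const h

/-- Regularization: `g` need not be differentiable, so the previous lemma is applied to difference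
quotients of a primitive `F`. Their first two derivatives are the difference quotients of `f` and of
`g`, and the step then tends to zero. -/
lemma MatrixMonotoneOn.interpolation_form_nonneg {I : Set ℝ} (hI : IsOpen I) (hc : Convex ℝ I)
    {f g : ℝ → ℝ} (hf : ∀ x ∈ I, HasDerivAt f (g x) x) (hg : MatrixMonotoneOn 2 I g)
    {k l m : ℝ} (hkl : k < l) (hk : k ∈ I) (hl : l ∈ I) (hm : m ∈ I) (a b : ℝ) :
    0 ≤ a ^ 2 * (f m - f k - g k * (m - k)) +
      2 * a * b * (f m - f k - (f l - f k) / (l - k) * (m - k)) +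
      b ^ 2 * (f m - f l - g l * (m - l)) := by
  obtain ⟨F, hF⟩ := exists_antideriv hI hc (w := f)
    fun x hx => (hf x hx).continuousAt.continuousWithinAt
  have tF := fun x hx => tendsto_diffQuot (hF x hx)
  have tf := fun x hx => tendsto_diffQuot (hf x hx)
  refine ge_of_tendsto (((((tF m hm).sub (tF k hk)).sub ((tf k hk).mul_const (m - k))).const_mul
    (a ^ 2)).add ((((tF m hm).sub (tF k hk)).sub ((((tF l hl).sub (tF k hk)).div_const
    (l - k)).mul_const (m - k))).const_mul (2 * a * b)) |>.add
    ((((tF m hm).sub (tF l hl)).sub ((tf l hl).mul_const (m - l))).const_mul (b ^ 2))) ?_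
  have hadd : ∀ x ∈ I, ∀ᶠ h in 𝓝[>] (0 : ℝ), x + h ∈ I := fun x hx => by
    have : ContinuousAt (fun h : ℝ => x + h) 0 := by fun_prop
    exact (this.eventually_mem (hI.mem_nhds (by simpa using hx))).filter_mono nhdsWithin_le_nhds
  filter_upwards [hadd k hk, hadd l hl, hadd m hm, self_mem_nhdsWithin] with h ek el em eh
  have hh : 0 < h := eh
  refine interpolation_form_nonneg_of_loewner (J := {x | x ∈ I ∧ x + h ∈ I}) ?_
    (fun x hx => hasDerivAt_diffQuot (hF x hx.1) (hF _ hx.2))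
    (fun x hx => hasDerivAt_diffQuot (hf x hx.1) (hf _ hx.2)) ?_ hkl ⟨hk, ek⟩ ⟨hl, el⟩ ⟨hm, em⟩ a b
  · refine convex_iff_ordConnected.mpr ⟨fun x hx y hy z hz => ⟨hc.ordConnected.out hx.1 hy.1 hz, ?_⟩⟩
    exact hc.ordConnected.out hx.2 hy.2 ⟨by linarith [hz.1], by linarith [hz.2]⟩
  intro p Δ hΔ hp hq a b
  suffices hs : ∀ᶠ ε in 𝓝[>] (0 : ℝ),
      0 ≤ formIncrement (fun x => (f (x + h) - f x) / h) Δ a b ε p from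
    loewner_form_nonneg_of_formIncrement hΔ (hasDerivAt_diffQuot (hf p hp.1) (hf _ hp.2))
      (hasDerivAt_diffQuot (hf _ hq.1) (hf _ hq.2)) hs
  have c1 : ContinuousAt (fun ε => p + lowerShift Δ a b ε) 0 :=
    ((hasDerivAt_lowerShift hΔ a b).const_add p).continuousAt
  have c2 : ContinuousAt (fun ε => p + Δ + upperShift Δ a b ε) 0 :=
    ((hasDerivAt_upperShift hΔ a b).const_add (p + Δ)).continuousAt
  have m1 := c1.eventually_mem (hI.mem_nhds (by simpa [lowerShift_zero hΔ] using hp.1))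
  have m2 := c2.eventually_mem (hI.mem_nhds (by simpa [upperShift_zero hΔ] using hq.1))
  have m1' := (c1.add_const h).eventually_mem
    (hI.mem_nhds (by simpa [lowerShift_zero hΔ] using hp.2))
  have m2' := (c2.add_const h).eventually_mem
    (hI.mem_nhds (by simpa [upperShift_zero hΔ] using hq.2))
  have m3 := (hasDerivAt_eigenGap hΔ a b).continuousAt.eventually_ne
    (show eigenGap Δ a b 0 ≠ 0 by rw [eigenGap_zero hΔ]; exact hΔ.ne')
  filter_upwards [m1.filter_mono nhdsWithin_le_nhds, m2.filter_mono nhdsWithin_le_nhds,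
    m1'.filter_mono nhdsWithin_le_nhds, m2'.filter_mono nhdsWithin_le_nhds,
    m3.filter_mono nhdsWithin_le_nhds, self_mem_nhdsWithin] with ε k1 k2 k1' k2' k3 k4
  exact hg.formIncrement_diffQuot_nonneg hc hf hh hΔ (le_of_lt k4) k3 hp.1 hq.1 k1 k2 hp.2 hq.2
    k1' k2'

/-- A function with matrix monotone derivative of order two is matrix convex of order two. -/
lemma MatrixMonotoneOn.matrixConvexOn {I : Set ℝ} (hI : IsOpen I) (hc : Convex ℝ I)
    {f g : ℝ → ℝ} (hf : ∀ x ∈ I, HasDerivAt f (g x) x) (hg : MatrixMonotoneOn 2 I g) :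
    MatrixConvexOn 2 I f := by
  refine matrixConvexOn_of_interpolationError hc fun l hl m hm => ?_
  have hK : interpolationError f l m = symMat (f m - f (l 0) - g (l 0) * (m - l 0))
      (f m - f (l 0) - dslope f (l 0) (l 1) * (m - l 0))
      (f m - f (l 1) - g (l 1) * (m - l 1)) := by
    -- The interpolant through two nodes does not depend on which is the base point, so the matrix
    -- is symmetric.
    have e : f m - f (l 1) - dslope f (l 1) (l 0) * (m - l 1) =
        f m - f (l 0) - dslope f (l 0) (l 1) * (m - l 0) := by
      rw [dslope_comm f (l 1) (l 0)]
      linear_combination dslope_mul_sub f (l 0) (l 1)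
    have e' := congrArg (fun t : ℝ => (t : ℂ)) e
    push_cast at e'
    ext i j
    fin_cases i <;> fin_cases j <;>
      simp [interpolationError, symMat, (hf _ (hl _)).deriv, e']
  rw [hK]
  refine posSemidef_symMat fun a b => ?_
  have hds : ∀ s t : ℝ, s < t → (f t - f s) / (t - s) = dslope f s t := fun s t hst => by
    rw [dslope_of_ne f hst.ne', slope_def_field]
  rcases lt_trichotomy (l 0) (l 1) with h | h | h
  · have := hg.interpolation_form_nonneg hI hc hf h (hl 0) (hl 1) hm a b
    rwa [hds _ _ h] at this
  · rw [h, dslope_same, (hf _ (hl 1)).deriv]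
    -- With coinciding nodes all entries equal this tangent error; an auxiliary second node with
    -- vector `(1, 0)` isolates it.
    have hnn : 0 ≤ f m - f (l 1) - g (l 1) * (m - l 1) := by
      obtain ⟨q, hq, hpq⟩ : ∃ q, q ∈ I ∧ l 1 < q := by
        have : ∀ᶠ q in 𝓝[>] (l 1), q ∈ I := mem_nhdsWithin_of_mem_nhds (hI.mem_nhds (hl 1))
        exact (this.and self_mem_nhdsWithin).exists
      have := hg.interpolation_form_nonneg hI hc hf hpq (hl 1) hq hm 1 0
      linarith
    refine (mul_nonneg (sq_nonneg (a + b)) hnn).trans_eq ?_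
    ring
  · have := hg.interpolation_form_nonneg hI hc hf h (hl 1) (hl 0) hm b a
    rw [hds _ _ h, dslope_comm] at this
    have e := dslope_mul_sub f (l 0) (l 1)
    refine this.trans_eq ?_
    linear_combination 2 * a * b * e

/-! ### The exponential and the theorem -/

lemma isOpen_openInterval (a b : EReal) : IsOpen (openInterval a b) :=
  isOpen_Ioo.preimage continuous_coe_real_ereal

lemma convex_openInterval (a b : EReal) : Convex ℝ (openInterval a b) :=
  convex_iff_ordConnected.mpr ⟨fun _ hx _ hy _ hz =>
    ⟨hx.1.trans_le (EReal.coe_le_coe_iff.mpr hz.1), (EReal.coe_le_coe_iff.mpr hz.2).trans_lt hy.2⟩⟩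

/-- No primitive of the exponential is matrix monotone of order two. -/
lemma not_matrixMonotoneOn_of_hasDerivAt_exp {I : Set ℝ} (hI : IsOpen I) (hc : Convex ℝ I)
    (hne : I.Nonempty) {f : ℝ → ℝ} (hf : ∀ t ∈ I, HasDerivAt f (Real.exp t) t) :
    ¬ MatrixMonotoneOn 2 I f := by
  intro hm
  obtain ⟨p, hp⟩ := hne
  obtain ⟨q, hq, hpq⟩ : ∃ q, q ∈ I ∧ p < q := by
    have : ∀ᶠ q in 𝓝[>] p, q ∈ I := mem_nhdsWithin_of_mem_nhds (hI.mem_nhds hp)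
    exact (this.and self_mem_nhdsWithin).exists
  obtain ⟨u, rfl⟩ : ∃ u, q = p + 2 * u := ⟨(q - p) / 2, by ring⟩
  have hu : 0 < u := by linarith
  have hdiff : f (p + 2 * u) - f p = Real.exp (p + 2 * u) - Real.exp p := by
    have hsub : Icc p (p + 2 * u) ⊆ I := hc.ordConnected.out hp hq
    have hd : ∀ x ∈ Icc p (p + 2 * u), HasDerivAt (fun t => f t - Real.exp t) 0 x := fun x hx =>
      ((hf x (hsub hx)).sub (Real.hasDerivAt_exp x)).congr_deriv (sub_self _)
    have := constant_of_has_deriv_right_zero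
      (fun x hx => (hd x hx).continuousAt.continuousWithinAt)
      (fun x hx => (hd x (Ico_subset_Icc_self hx)).hasDerivWithinAt) (p + 2 * u)
      (right_mem_Icc.mpr (by linarith))
    linarith
  -- The vector `(e^u, -1)` balances the diagonal entries `e^p` and `e^(p+2u)`; the form becomes a
  -- positive multiple of `u - sinh u`.
  have key := hm.loewner_form_nonneg hI (p := p) (Δ := 2 * u) (by linarith) hp hq (hf p hp)
    (hf _ hq) (Real.exp u) (-1)
  rw [hdiff] at key
  have hs := Real.self_lt_sinh_iff.mpr hu
  rw [Real.sinh_eq] at hs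
  have e1 : Real.exp (p + 2 * u) = Real.exp p * Real.exp u ^ 2 := by
    rw [Real.exp_add, two_mul, Real.exp_add]; ring
  have e2 : Real.exp (-u) * Real.exp u = 1 := by rw [← Real.exp_add]; simp
  rw [e1] at key
  set E := Real.exp u
  set N := Real.exp (-u)
  set P := Real.exp p
  have hP : 0 < P := Real.exp_pos p
  have hE : 0 < E := Real.exp_pos u
  have h3 : E ^ 2 * P + (-1) ^ 2 * (P * E ^ 2) + 2 * E * -1 * ((P * E ^ 2 - P) / (2 * u)) =
      P * E ^ 2 / u * (2 * u - (E - N)) := by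
    field_simp
    linear_combination -e2
  rw [h3] at key
  have : P * E ^ 2 / u * (2 * u - (E - N)) < 0 :=
    mul_neg_of_pos_of_neg (by positivity) (by linarith)
  linarith

theorem mainTheorem8 (a b : EReal) (hab : a < b) :
    (∀ f : ℝ → ℝ, MatrixConvexOn 2 (openInterval a b) f →
      DifferentiableOn ℝ f (openInterval a b) ∧ deriv f ∈ ClassQ 2 (openInterval a b)) ∧
    (∀ f : ℝ → ℝ, DifferentiableOn ℝ f (openInterval a b) →
      MatrixMonotoneOn 2 (openInterval a b) (deriv f) →
      MatrixConvexOn 2 (openInterval a b) f) ∧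
    (Real.exp ∈ ClassQ 2 (openInterval a b) ∧
      ¬ ∃ f : ℝ → ℝ, MatrixConvexOn 2 (openInterval a b) f ∧
        MatrixMonotoneOn 2 (openInterval a b) f ∧
        ∀ t ∈ openInterval a b, HasDerivAt f (Real.exp t) t) := by
  have hI := isOpen_openInterval a b
  have hc := convex_openInterval a b
  refine ⟨fun f hf => hf.deriv_mem_classQ hI hc, fun f hf hm => ?_, ?_, ?_⟩
  · exact hm.matrixConvexOn hI hc fun x hx =>
      (hf.differentiableAt (hI.mem_nhds hx)).hasDerivAt
  · exact mem_classQ_two_of_convexOn hI (fun x _ => Real.hasDerivAt_exp x)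
      (convexOn_exp.subset (subset_univ _) hc)
  · rintro ⟨f, -, hm, hf⟩
    exact not_matrixMonotoneOn_of_hasDerivAt_exp hI hc
      (EReal.lt_iff_exists_real_btwn.mp hab) hf hm
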